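/- Let $\ell>0$ and $0<\alpha<\theta<\pi/2$. Consider the rectangular trapezoid of height $1/2$ whose shorter base has length $\ell$ and whose slanted leg forms the angle $\alpha$ with the direction of the perpendicular leg. Draw it with the perpendicular leg along the horizontal axis, as $$\{(x,y) : 0\le x\le \tfrac12,\ 0\le y\le b(x)\},\qquad b(x)=\ell+\tan\alpha\,\bigl(\tfrac12-|x|\bigr),$$ and let $\mathcal Q=\{(x,y): |x|\le \tfrac12,\ |y|\le b(x)\}$ be the 4-fold copy of it obtained by reflection in the two axes. Identify opposite boundary points of $\mathcal Q$: $(-\tfrac12,y)\sim(\tfrac12,y)$ for $|y|\le \ell$, and $(x,-b(x))\sim(x,b(x))$ for $|x|\le\tfrac12$. The linear flow of direction $\theta$ on the resulting surface is the motion with constant velocity $(\cos\theta,\sin\theta)$, where a trajectory that hits a boundary point of $\mathcal Q$ continues from the opposite boundary point with the same velocity. Let $\Sigma=[-\tfrac12,\tfrac12]\times\{0\}$, which, with its endpoints identified, is the circle $\mathbb T=\mathbb R/\mathbb Z$, and let $f_{\ell,\alpha,\theta}:\mathbb T\to\mathbb T$ be the first-return map of the flow to $\Sigma$. The rotation number $\rho(f)\in[0,1)$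 of an orientation-preserving circle homeomorphism $f$ with lift $F:\mathbb R\to\mathbb R$ is the fractional part of $\lim_{n\to\infty}(F^n(x)-x)/n$. **Theorem.** Let $\ell>0$. For all $0<\alpha<\theta<\pi/2$ the first-return map $f_{\ell,\alpha,\theta}$ is well defined (every point of $\Sigma$ has exactly one first-return point) and is a homeomorphism of $\mathbb T$. For Lebesgue-almost every $(\alpha,\theta)$ with $0<\alpha<\theta<\pi/2$, it is orientation-preserving and $$\rho(f_{\ell,\alpha,\theta})\in\mathbb Q .$$ -/

import Mathlib

open Set Filter Topology MeasureTheory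

namespace InternalWave

/-- The upper boundary of the unfolded table of the rectangular trapezoid of height `1/2`, with
shorter base `ℓ` and slanted leg at angle `α` to the line of the perpendicular leg. The
perpendicular leg is drawn along the abscissa axis, so the longer base, of length
`ℓ + tan α / 2`, lies over `x = 0`, and the shorter base, of length `ℓ`, over `x = 1/2`. -/
noncomputable def upperBoundary (ℓ α x : ℝ) : ℝ := ℓ + Real.tan α * (1 / 2 - |x|)

/-- The unfolded table, the 4-fold copy of the trapezoid
`{(x, y) | 0 ≤ x ≤ 1/2, 0 ≤ y ≤ upperBoundary ℓ α x}` by reflection in the two axes. -/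
def unfoldedTable (ℓ α : ℝ) : Set (ℝ × ℝ) :=
  {p | |p.1| ≤ 1 / 2 ∧ |p.2| ≤ upperBoundary ℓ α p.1}

/-- Opposite boundary points: on the left and right sides with the same ordinate, or on the
lower and upper sides with the same abscissa. -/
def Opposite (ℓ α : ℝ) (p q : unfoldedTable ℓ α) : Prop :=
  (p.1.1 = -(1 / 2) ∧ q.1.1 = 1 / 2 ∧ p.1.2 = q.1.2) ∨
  (p.1.1 = q.1.1 ∧ p.1.2 = -upperBoundary ℓ α p.1.1 ∧ q.1.2 = upperBoundary ℓ α q.1.1)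

/-- The surface obtained from the unfolded table by identifying opposite boundary points
(`Quot` divides by the equivalence relation generated by `Opposite`). -/
def Surface (ℓ α : ℝ) : Type := Quot (Opposite ℓ α)

/-- The unit vector of direction `θ`. -/
noncomputable def direction (θ : ℝ) : ℝ × ℝ := (Real.cos θ, Real.sin θ)

/-- `γ`, restricted to the time interval `[0, T]`, is an arc of trajectory of the linear flow of
direction `θ` on the surface. Just after each time `t < T` and just before each time `t > 0` it
moves in the table with velocity `direction θ`, starting from, respectively arriving at, some
representative `p` of the point `γ t`. Thus when it arrives at a boundary point it continues from
the opposite boundary point with the same velocity. -/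
structure IsTrajectoryArc (ℓ α θ T : ℝ) (γ : ℝ → Surface ℓ α) : Prop where
  forward : ∀ t ∈ Ico 0 T, ∃ p : ℝ × ℝ, ∃ ε > 0, ∀ s ∈ Ico 0 ε,
    ∃ h : p + s • direction θ ∈ unfoldedTable ℓ α, γ (t + s) = Quot.mk _ ⟨_, h⟩
  backward : ∀ t ∈ Ioc 0 T, ∃ p : ℝ × ℝ, ∃ ε > 0, ∀ s ∈ Ico 0 ε,
    ∃ h : p - s • direction θ ∈ unfoldedTable ℓ α, γ (t - s) = Quot.mk _ ⟨_, h⟩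

/-- `P` is the point of the cross-section `Σ` (the horizontal segment `[-1/2, 1/2] × {0}`, closed
up to a circle by the identification of its endpoints) which corresponds to `x ∈ ℝ/ℤ`. -/
def IsSectionPoint (ℓ α : ℝ) (x : UnitAddCircle) (P : Surface ℓ α) : Prop :=
  ∃ a : ℝ, (a : UnitAddCircle) = x ∧
    ∃ h : (a, 0) ∈ unfoldedTable ℓ α, P = Quot.mk _ ⟨(a, 0), h⟩

/-- The trajectory of the linear flow of direction `θ` that starts at `x ∈ Σ` returns to `Σ` for
the first time at `x'`. -/
def IsFirstReturn (ℓ α θ : ℝ) (x x' : UnitAddCircle) : Prop :=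
  ∃ (T : ℝ) (γ : ℝ → Surface ℓ α), 0 < T ∧ IsTrajectoryArc ℓ α θ T γ ∧
    IsSectionPoint ℓ α x (γ 0) ∧ IsSectionPoint ℓ α x' (γ T) ∧
    ∀ t ∈ Ioo 0 T, ∀ z, ¬ IsSectionPoint ℓ α z (γ t)

/-- The first-return (Poincaré) map of the linear flow of direction `θ` to the section `Σ ≅ ℝ/ℤ`.
(It is selected among all first-return points; there is always exactly one.) -/
noncomputable def returnMap (ℓ α θ : ℝ) (x : UnitAddCircle) : UnitAddCircle :=
  Classical.epsilon (IsFirstReturn ℓ α θ x)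

/-- `F` is a lift of the circle map `f`: an increasing homeomorphism of `ℝ` with
`F (x + 1) = F x + 1` that induces `f` on `ℝ/ℤ`. -/
structure IsLift (f : UnitAddCircle → UnitAddCircle) (F : CircleDeg1Lift) : Prop where
  continuous : Continuous F
  strictMono : StrictMono F
  semiconj : ∀ x : ℝ, ((F x : ℝ) : UnitAddCircle) = f (x : UnitAddCircle)

/-- `ρ ∈ [0, 1)` is the rotation number of `f`: the fractional part of the translation number
`lim (Fⁿ x - x) / n` of a lift `F` of `f`. -/
def HasRotationNumber (f : UnitAddCircle → UnitAddCircle) (ρ : ℝ) : Prop :=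
  ∃ F : CircleDeg1Lift, IsLift f F ∧ ρ = Int.fract F.translationNumber

end InternalWave

namespace InternalWave

/-! A trajectory leaving the section at `a` reaches the upper side at an abscissa `x` with `lowerMap
k x = a + s`. It continues from the lower side at the same abscissa and returns to the section at
`upperMap k x + s`. Here `k = tan α / tan θ` and `s = ℓ cot θ + k / 4`. The condition `α < θ` means
`k < 1`, which makes both maps increasing homeomorphisms of the line. Up to conjugation by a
translation, the lift of the return map is therefore `centredMap k + t` with `t = 2 s`: a rigid
rotation composed with a piecewise affine map of two slopes, `slope k` and its inverse. It suffices
that for each fixed `k` almost every `t` gives a rational rotation number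
(`volume_irrational_rotation`). Fubini in the coordinates `(k, cot θ)` and a differentiable change
of variables then give the statement for `(α, θ)`.

For fixed `k` the proof is a Lebesgue density argument. If `t` has irrational rotation number, then
arbitrarily short intervals having `t` as an endpoint contain a phase-locking interval occupying at
least the proportion `k` of their length (`exists_rational_piece`). Such a `t` is not a density
point of the irrational set.

The lower bound for the locking interval comes from reversibility. Since the wave is even, `x ↦ N -
centredMap k x` and `x ↦ N + t - x` are involutions conjugating the map to its inverse, and the
break points are the fixed points of the former. Hence a break point has odd period `2 m + 1`
exactly when its iterate `m + 1` is a midpoint `(N + t) / 2`. Locking to `p / (2 m + 1)` holds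
between the parameter `r₁` at which the even break point is periodic and the parameter `r₂` at which
the odd one is. At `r₂` the even break point's orbit cuts a gap of the periodic orbit in the ratio
of the two slopes, so it sits at `k` times the half-gap from the midpoint (`offset_of_periodic`).
Its distance from the midpoint is affine in the parameter, vanishes at `r₁`, and at `t` is still at
most the half-gap measured at `r₂`. Comparing the values gives `r₂ - r₁ ≥ k (t - r₁)`. Farey
neighbours with odd denominators (`exists_odd_farey`) make this applicable at every irrational
rotation number and at every scale. -/

/-! ### The triangle wave. -/

/-- The triangle wave of period `1`, slopes `±k` and mean `0`, with maxima at the integers. -/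
noncomputable def wave (k x : ℝ) : ℝ := k * (1 / 4 - |x - round x|)

lemma abs_sub_round_lipschitz (x y : ℝ) : |x - round x| ≤ |y - round y| + |x - y| := by
  calc |x - round x| ≤ |x - round y| := round_le x (round y)
    _ = |(x - y) + (y - round y)| := by ring_nf
    _ ≤ |x - y| + |y - round y| := abs_add_le _ _
    _ = _ := add_comm _ _

lemma wave_sub_le {k : ℝ} (hk : 0 ≤ k) (x y : ℝ) : wave k x - wave k y ≤ k * |x - y| := by
  have := abs_sub_round_lipschitz y x
  rw [abs_sub_comm y x] at this
  unfold wave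
  nlinarith

lemma abs_wave_sub_le {k : ℝ} (hk : 0 ≤ k) (x y : ℝ) : |wave k x - wave k y| ≤ k * |x - y| := by
  rw [abs_le]
  have h1 := wave_sub_le hk x y
  have h2 := wave_sub_le hk y x
  rw [abs_sub_comm y x] at h2
  constructor <;> linarith

lemma continuous_wave {k : ℝ} (hk : 0 ≤ k) : Continuous (wave k) := by
  refine (LipschitzWith.of_dist_le_mul (K := k.toNNReal) fun x y => ?_).continuous
  rw [Real.dist_eq, Real.dist_eq, Real.coe_toNNReal _ hk]
  exact abs_wave_sub_le hk x y

lemma wave_add_int (k x : ℝ) (n : ℤ) : wave k (x + n) = wave k x := by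
  simp only [wave, round_add_intCast]
  push_cast
  congr 3
  ring

lemma wave_add_one (k x : ℝ) : wave k (x + 1) = wave k x := by
  exact_mod_cast wave_add_int k x 1

lemma wave_eq_of_abs_le {k x : ℝ} {n : ℤ} (h : |x - n| ≤ 1 / 2) :
    wave k x = k * (1 / 4 - |x - n|) := by
  have h1 := round_le x n
  have h2 : |x - n| ≤ |x - round x| := by
    rcases eq_or_ne n (round x) with rfl | hne
    · exact le_rfl
    · have h3 : (1 : ℝ) ≤ |(n : ℝ) - round x| := by
        rw [← Int.cast_sub, ← Int.cast_abs]
        exact_mod_cast Int.one_le_abs (sub_ne_zero.2 hne)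
      have h4 : |(n : ℝ) - round x| ≤ |x - n| + |x - round x| := by
        rw [abs_sub_comm x n]
        calc |(n : ℝ) - round x| = |(n - x) + (x - round x)| := by ring_nf
          _ ≤ _ := abs_add_le _ _
      linarith
  rw [wave, le_antisymm h1 h2]

lemma wave_neg (k x : ℝ) : wave k (-x) = wave k x := by
  rw [wave_eq_of_abs_le (k := k) (abs_sub_round x),
    wave_eq_of_abs_le (k := k) (x := -x) (n := -round x)]
  · rw [abs_sub_comm x]; push_cast; ring_nf
  · rw [show (-x - ((-round x : ℤ) : ℝ)) = -(x - round x) by push_cast; ring, abs_neg]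
    exact abs_sub_round x

lemma wave_eq_right {k x : ℝ} (n : ℤ) (h0 : (n : ℝ) ≤ x) (h1 : x ≤ n + 1 / 2) :
    wave k x = k * (1 / 4 - (x - n)) := by
  have h : |x - n| = x - n := abs_of_nonneg (by linarith)
  rw [wave_eq_of_abs_le (n := n) (by rw [h]; linarith), h]

lemma wave_eq_left {k x : ℝ} (n : ℤ) (h0 : (n : ℝ) - 1 / 2 ≤ x) (h1 : x ≤ n) :
    wave k x = k * (1 / 4 - (n - x)) := by
  have h : |x - n| = n - x := by rw [abs_sub_comm]; exact abs_of_nonneg (by linarith)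
  rw [wave_eq_of_abs_le (n := n) (by rw [h]; linarith), h]

lemma wave_add_half (k x : ℝ) : wave k (x + 1 / 2) = -wave k x := by
  have h0 := Int.floor_le x
  have h1 := Int.lt_floor_add_one x
  rcases le_total x (⌊x⌋ + 1 / 2) with h | h
  · rw [wave_eq_right ⌊x⌋ h0 h, wave_eq_left (⌊x⌋ + 1) (by push_cast; linarith)
      (by push_cast; linarith)]
    push_cast; ring
  · rw [wave_eq_left (x := x) (⌊x⌋ + 1) (by push_cast; linarith) (by push_cast; linarith),
      wave_eq_right (⌊x⌋ + 1) (by push_cast; linarith) (by push_cast; linarith)]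
    push_cast; ring

lemma abs_wave_le {k : ℝ} (hk : 0 ≤ k) (x : ℝ) : |wave k x| ≤ k := by
  have h1 := abs_sub_round x
  have h2 := abs_nonneg (x - round x)
  rw [wave, abs_le]
  constructor <;> nlinarith

/-! ### The piecewise affine circle map and its symmetries. -/

/-- The abscissa of the section point whose trajectory hits the upper boundary at abscissa `x`
(for the wave without its mean value). -/
noncomputable def lowerMap (k x : ℝ) : ℝ := x - wave k x

/-- The abscissa at which the trajectory that leaves the lower boundary at abscissa `x` meets the
section (for the wave without its mean value). -/
noncomputable def upperMap (k x : ℝ) : ℝ := x + wave k x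

variable (k : Ioo (0 : ℝ) 1)

lemma strictMono_lowerMap : StrictMono (lowerMap k) := by
  intro x y h
  have h1 := wave_sub_le k.2.1.le y x
  rw [abs_of_pos (sub_pos.2 h)] at h1
  have := k.2.2
  unfold lowerMap
  nlinarith

lemma strictMono_upperMap : StrictMono (upperMap k) := by
  intro x y h
  have h1 := wave_sub_le k.2.1.le x y
  rw [abs_sub_comm, abs_of_pos (sub_pos.2 h)] at h1
  have := k.2.2
  unfold upperMap
  nlinarith

lemma continuous_lowerMap : Continuous (lowerMap k) :=
  continuous_id.sub (continuous_wave k.2.1.le)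

lemma continuous_upperMap : Continuous (upperMap k) :=
  continuous_id.add (continuous_wave k.2.1.le)

lemma surjective_lowerMap : Function.Surjective (lowerMap k) := by
  refine (continuous_lowerMap k).surjective ?_ ?_
  · refine tendsto_atTop_mono (fun x => ?_) (tendsto_atTop_add_const_right _ (-(k : ℝ)) tendsto_id)
    have := (abs_le.1 (abs_wave_le k.2.1.le x)).2
    simp only [lowerMap, id]; linarith
  · refine tendsto_atBot_mono (fun x => ?_) (tendsto_atBot_add_const_right _ (k : ℝ) tendsto_id)
    have := (abs_le.1 (abs_wave_le k.2.1.le x)).1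
    simp only [lowerMap, id]; linarith

lemma surjective_upperMap : Function.Surjective (upperMap k) := by
  refine (continuous_upperMap k).surjective ?_ ?_
  · refine tendsto_atTop_mono (fun x => ?_) (tendsto_atTop_add_const_right _ (-(k : ℝ)) tendsto_id)
    have := (abs_le.1 (abs_wave_le k.2.1.le x)).1
    simp only [upperMap, id]; linarith
  · refine tendsto_atBot_mono (fun x => ?_) (tendsto_atBot_add_const_right _ (k : ℝ) tendsto_id)
    have := (abs_le.1 (abs_wave_le k.2.1.le x)).2
    simp only [upperMap, id]; linarith

/-- The inverse of `lowerMap`. -/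
noncomputable def foot : ℝ ≃o ℝ :=
  ((strictMono_lowerMap k).orderIsoOfSurjective _ (surjective_lowerMap k)).symm

lemma lowerMap_foot (x : ℝ) : lowerMap k (foot k x) = x :=
  ((strictMono_lowerMap k).orderIsoOfSurjective _ (surjective_lowerMap k)).apply_symm_apply x

lemma foot_lowerMap (x : ℝ) : foot k (lowerMap k x) = x :=
  ((strictMono_lowerMap k).orderIsoOfSurjective _ (surjective_lowerMap k)).symm_apply_apply x

lemma foot_lt_iff (x c : ℝ) : foot k x < c ↔ x < lowerMap k c := by
  rw [← (strictMono_lowerMap k).lt_iff_lt, lowerMap_foot]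

lemma foot_add_one (x : ℝ) : foot k (x + 1) = foot k x + 1 := by
  apply (strictMono_lowerMap k).injective
  have h := lowerMap_foot k x
  rw [lowerMap_foot]
  rw [lowerMap, wave_add_one] at *
  linarith

/-- The return map to the section, up to rotations before and after. -/
noncomputable def centredMap (x : ℝ) : ℝ := upperMap k (foot k x)

lemma strictMono_centredMap : StrictMono (centredMap k) :=
  (strictMono_upperMap k).comp (foot k).strictMono

lemma continuous_centredMap : Continuous (centredMap k) :=
  (continuous_upperMap k).comp (foot k).continuous

lemma centredMap_add_one (x : ℝ) : centredMap k (x + 1) = centredMap k x + 1 := by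
  rw [centredMap, foot_add_one, upperMap, wave_add_one, centredMap, upperMap]
  ring

lemma centredMap_lowerMap (x : ℝ) : centredMap k (lowerMap k x) = upperMap k x := by
  rw [centredMap, foot_lowerMap]

/-- Evenness of the wave: `y ↦ n - y` carries `upperMap` to `n - lowerMap`, so `x ↦ n - centredMap k
x` is an involution. This is the reversibility on which the proof rests. -/
lemma centredMap_int_sub (x : ℝ) (n : ℤ) : centredMap k (n - centredMap k x) = n - x := by
  obtain ⟨y, rfl⟩ : ∃ y, lowerMap k y = x := ⟨_, lowerMap_foot k x⟩
  have h : n - upperMap k y = lowerMap k (n - y) := by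
    have h1 : wave k (n - y) = wave k y := by
      rw [sub_eq_add_neg, add_comm, wave_add_int, wave_neg]
    rw [upperMap, lowerMap, h1]; ring
  have h1 : wave k (n - y) = wave k y := by
    rw [sub_eq_add_neg, add_comm, wave_add_int, wave_neg]
  rw [centredMap_lowerMap, h, centredMap_lowerMap, upperMap, h1, lowerMap]
  ring

/-- The wave is odd under the half-period shift and even under reflection. This symmetry later
exchanges the parameters `t` and `-t`. -/
lemma centredMap_add_half (x : ℝ) : centredMap k (x + 1 / 2) = 1 / 2 - centredMap k (-x) := by
  obtain ⟨y, rfl⟩ := surjective_upperMap k x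
  have h : upperMap k y + 1 / 2 = lowerMap k (y + 1 / 2) := by
    rw [upperMap, lowerMap, wave_add_half]; ring
  have h' : -upperMap k y = lowerMap k (-y) := by
    rw [upperMap, lowerMap, wave_neg]; ring
  rw [h, h', centredMap_lowerMap, centredMap_lowerMap, upperMap, upperMap, wave_add_half, wave_neg]
  ring

/-! ### Break points and affine branches. -/

/-- The break points of `centredMap`. -/
noncomputable def breakPoint (n : ℤ) : ℝ := lowerMap k (n / 2)

lemma strictMono_breakPoint : StrictMono (breakPoint k) := fun m n h =>
  strictMono_lowerMap k (by have : (m : ℝ) < n := by exact_mod_cast h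
                            linarith)

lemma breakPoint_add_two_mul (n m : ℤ) : breakPoint k (n + 2 * m) = breakPoint k n + m := by
  rw [breakPoint, breakPoint, lowerMap, lowerMap,
    show ((n + 2 * m : ℤ) : ℝ) / 2 = n / 2 + m by push_cast; ring, wave_add_int]
  ring

/-- Break points are the fixed points of the reversing involutions `x ↦ n - centredMap k x`. -/
lemma centredMap_breakPoint (n : ℤ) : centredMap k (breakPoint k n) = n - breakPoint k n := by
  rw [breakPoint, centredMap_lowerMap, upperMap, lowerMap]
  ring

lemma exists_breakPoint_le_lt (x : ℝ) : ∃ n, breakPoint k n ≤ x ∧ x < breakPoint k (n + 1) := by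
  refine ⟨⌊2 * foot k x⌋, ?_, ?_⟩
  · rw [← not_lt, breakPoint, ← foot_lt_iff]
    have := Int.floor_le (2 * foot k x)
    linarith
  · rw [breakPoint, ← foot_lt_iff]
    have := Int.lt_floor_add_one (2 * foot k x)
    push_cast
    linarith

/-- The slope of `centredMap` to the left of the breakpoints of even index. -/
noncomputable def slope : ℝ := (1 + k) / (1 - k)

lemma slope_pos : 0 < slope k := div_pos (by linarith [k.2.1]) (by linarith [k.2.2])

lemma foot_mem_Icc {n : ℤ} {x : ℝ} (h : x ∈ Icc (breakPoint k n) (breakPoint k (n + 1))) :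
    (n : ℝ) / 2 ≤ foot k x ∧ foot k x ≤ n / 2 + 1 / 2 := by
  obtain ⟨h1, h2⟩ := h
  rw [← not_lt, breakPoint] at h1 h2
  constructor
  · rwa [← not_lt, foot_lt_iff]
  · rw [← not_lt, ← (strictMono_lowerMap k).lt_iff_lt, lowerMap_foot]
    convert h2 using 4
    push_cast; ring

/-- `centredMap` is affine between consecutive break points. -/
lemma centredMap_sub_of_even (n : ℤ) {x y : ℝ}
    (hx : x ∈ Icc (breakPoint k (2 * n)) (breakPoint k (2 * n + 1)))
    (hy : y ∈ Icc (breakPoint k (2 * n)) (breakPoint k (2 * n + 1))) :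
    centredMap k y - centredMap k x = (slope k)⁻¹ * (y - x) := by
  obtain ⟨a1, a2⟩ := foot_mem_Icc k hx
  obtain ⟨b1, b2⟩ := foot_mem_Icc k hy
  push_cast at a1 a2 b1 b2
  have hx := lowerMap_foot k x
  have hy := lowerMap_foot k y
  rw [lowerMap, wave_eq_right n (by linarith) (by linarith)] at hx hy
  rw [centredMap, centredMap, upperMap, upperMap, wave_eq_right n (by linarith) (by linarith),
    wave_eq_right n (by linarith) (by linarith), ← hx, ← hy, slope, inv_div]
  have : (1 : ℝ) + k ≠ 0 := by linarith [k.2.1]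
  rw [hx, hy]
  field_simp
  nth_rewrite 3 [← hx]
  nth_rewrite 3 [← hy]
  ring

lemma centredMap_sub_of_odd (n : ℤ) {x y : ℝ}
    (hx : x ∈ Icc (breakPoint k (2 * n - 1)) (breakPoint k (2 * n)))
    (hy : y ∈ Icc (breakPoint k (2 * n - 1)) (breakPoint k (2 * n))) :
    centredMap k y - centredMap k x = slope k * (y - x) := by
  have e : (2 * n : ℤ) = 2 * n - 1 + 1 := by ring
  rw [e, add_sub_cancel_right] at hx hy
  obtain ⟨a1, a2⟩ := foot_mem_Icc k hx
  obtain ⟨b1, b2⟩ := foot_mem_Icc k hy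
  push_cast at a1 a2 b1 b2
  have hx := lowerMap_foot k x
  have hy := lowerMap_foot k y
  rw [lowerMap, wave_eq_left n (by linarith) (by linarith)] at hx hy
  rw [centredMap, centredMap, upperMap, upperMap, wave_eq_left n (by linarith) (by linarith),
    wave_eq_left n (by linarith) (by linarith), slope]
  have : (1 : ℝ) - k ≠ 0 := by linarith [k.2.2]
  field_simp
  nth_rewrite 3 [← hx]
  nth_rewrite 3 [← hy]
  ring

lemma exists_centredMap_affine (n : ℤ) : ∃ σ > 0, ∀ x ∈ Icc (breakPoint k n) (breakPoint k (n + 1)),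
    ∀ y ∈ Icc (breakPoint k n) (breakPoint k (n + 1)),
      centredMap k y - centredMap k x = σ * (y - x) := by
  rcases Int.even_or_odd' n with ⟨m, rfl | rfl⟩
  · exact ⟨_, inv_pos.2 (slope_pos k), fun x hx y hy => centredMap_sub_of_even k m hx hy⟩
  · refine ⟨_, slope_pos k, fun x hx y hy => centredMap_sub_of_odd k (m + 1) ?_ ?_⟩
    · convert hx using 3 <;> ring
    · convert hy using 3 <;> ring

/-! ### The one-parameter family and reversibility of its orbits. -/

/-- The lift of the return map, up to conjugation by a rotation. -/
noncomputable def rotatedMap (t : ℝ) : CircleDeg1Lift where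
  toFun x := centredMap k x + t
  monotone' _ _ h := by
    have := (strictMono_centredMap k).monotone h
    linarith
  map_add_one' x := by
    rw [centredMap_add_one]
    ring

lemma rotatedMap_apply (t x : ℝ) : rotatedMap k t x = centredMap k x + t := rfl

lemma strictMono_rotatedMap (t : ℝ) : StrictMono (rotatedMap k t) := fun _ _ h => by
  have := strictMono_centredMap k h
  rw [rotatedMap_apply, rotatedMap_apply]
  linarith

lemma continuous_rotatedMap (t : ℝ) : Continuous (rotatedMap k t) :=
  (continuous_centredMap k).add continuous_const

lemma iterate_map_add_int (f : CircleDeg1Lift) (j : ℕ) (x : ℝ) (n : ℤ) :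
    f^[j] (x + n) = f^[j] x + n := by
  rw [← CircleDeg1Lift.coe_pow]
  exact (f ^ j).map_add_int x n

lemma iterate_le_imp_translationNumber_le {f : CircleDeg1Lift} {d : ℕ} {x : ℝ} {n : ℤ}
    (h : f^[d] x ≤ x + n) : d * f.translationNumber ≤ n := by
  rw [← CircleDeg1Lift.translationNumber_pow]
  rw [← CircleDeg1Lift.coe_pow] at h
  exact CircleDeg1Lift.translationNumber_le_of_le_add_int _ h

lemma le_iterate_imp_le_translationNumber {f : CircleDeg1Lift} {d : ℕ} {x : ℝ} {n : ℤ}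
    (h : x + n ≤ f^[d] x) : n ≤ d * f.translationNumber := by
  rw [← CircleDeg1Lift.translationNumber_pow]
  rw [← CircleDeg1Lift.coe_pow] at h
  exact CircleDeg1Lift.le_translationNumber_of_add_int_le _ h

/-- On a periodic orbit, the order of the points is that of a rotation. -/
lemma orbit_lt_imp {f : CircleDeg1Lift} (hf : StrictMono f) {q : ℕ} (hq : 0 < q) {x : ℝ} {p : ℤ}
    (hx : f^[q] x = x + p) {a b : ℕ} {n : ℤ} (h : f^[a] x + n < f^[b] x) :
    a * p + n * q < b * p := by
  have hper (a : ℕ) : (f^[a])^[q] x = x + a * p := by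
    rw [← Function.iterate_mul, mul_comm, Function.iterate_mul, ← CircleDeg1Lift.coe_pow]
    rw [← CircleDeg1Lift.coe_pow] at hx
    exact (f ^ q).iterate_eq_of_map_eq_add_int hx a
  have hT (l : ℕ) (y : ℝ) : (fun y => f^[a] y + n)^[l] y = (f^[a])^[l] y + l * n := by
    induction l with
    | zero => simp
    | succ l ih =>
      have := iterate_map_add_int f a ((f^[a])^[l] y) (l * n)
      rw [Function.iterate_succ_apply', Function.iterate_succ_apply', ih]
      push_cast at this ⊢
      rw [this]; ring
  have hcomm : Function.Commute (fun y => f^[a] y + n) (f^[b]) := fun y => by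
    simp only
    rw [iterate_map_add_int, ← Function.iterate_add_apply, add_comm a,
      Function.iterate_add_apply]
  -- For commuting increasing maps, a comparison at one point is equivalent to that of their `q`-th
  -- iterates, and here these are integer translations of `x`.
  have h2 := (hcomm.iterate_pos_lt_iff_map_lt (x := x) (n := q)
    (fun y z hyz => add_le_add_left ((hf.iterate a).monotone hyz) _) (hf.iterate b) hq).2 h
  rw [hT, hper, hper] at h2
  have : (a * p + n * q : ℝ) < b * p := by linarith
  exact_mod_cast this

/-- The reflection `x ↦ N + t - x` conjugates the map to its inverse. -/
lemma iterate_reversal (t : ℝ) (N : ℤ) (j : ℕ) (x : ℝ) :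
    (rotatedMap k t)^[j] (N + t - (rotatedMap k t)^[j] x) = N + t - x := by
  induction j with
  | zero => simp
  | succ j ih =>
    rw [Function.iterate_succ_apply, Function.iterate_succ_apply']
    have : rotatedMap k t (N + t - rotatedMap k t ((rotatedMap k t)^[j] x)) =
        N + t - (rotatedMap k t)^[j] x := by
      have h := centredMap_int_sub k ((rotatedMap k t)^[j] x) N
      rw [rotatedMap_apply, rotatedMap_apply, add_sub_add_right_eq_sub, h]
      ring
    rw [this, ih]

lemma strictMono_iterate (t : ℝ) (j : ℕ) : StrictMono (rotatedMap k t)^[j] :=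
  (strictMono_rotatedMap k t).iterate j

lemma rotatedMap_breakPoint (t : ℝ) (M : ℤ) :
    rotatedMap k t (breakPoint k M) = M + t - breakPoint k M := by
  rw [rotatedMap_apply, centredMap_breakPoint]; ring

lemma iterate_reflect_breakPoint (t : ℝ) (M N : ℤ) (j : ℕ) :
    (rotatedMap k t)^[j] (N + t - (rotatedMap k t)^[j + 1] (breakPoint k M)) =
      breakPoint k M + (N - M : ℤ) := by
  rw [Function.iterate_succ_apply, iterate_reversal, rotatedMap_breakPoint]
  push_cast; ring

/-- A point lies to the left of the fixed point of a decreasing involution exactly when it lies to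
the left of its own image. -/
lemma lt_breakPoint_iff (N : ℤ) (x : ℝ) : x < breakPoint k N ↔ x < N - centredMap k x := by
  constructor
  · intro h
    have := strictMono_centredMap k h
    rw [centredMap_breakPoint] at this
    linarith
  · intro h
    by_contra! h2
    have := (strictMono_centredMap k).monotone h2
    rw [centredMap_breakPoint] at this
    linarith

lemma breakPoint_lt_iff (N : ℤ) (x : ℝ) : breakPoint k N < x ↔ N - centredMap k x < x := by
  constructor
  · intro h
    have := strictMono_centredMap k h
    rw [centredMap_breakPoint] at this
    linarith
  · intro h
    by_contra! h2
    have := (strictMono_centredMap k).monotone h2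
    rw [centredMap_breakPoint] at this
    linarith

lemma reflect_eq (t : ℝ) (M N : ℤ) (j : ℕ) :
    (rotatedMap k t)^[j] (N - centredMap k ((rotatedMap k t)^[j] (breakPoint k M))) =
      breakPoint k M + (N - M : ℤ) := by
  rw [← iterate_reflect_breakPoint k t M N j, Function.iterate_succ_apply', rotatedMap_apply]
  congr 1; ring

/-- Reflecting the half-orbit from one break point in the involution fixing the other doubles the
time. Order relative to break points thus becomes a comparison with an integer translation, which
the rotation number controls. -/
lemma iterate_lt_breakPoint_iff (t : ℝ) (M N : ℤ) (j : ℕ) :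
    (rotatedMap k t)^[j] (breakPoint k M) < breakPoint k N ↔
      (rotatedMap k t)^[2 * j] (breakPoint k M) < breakPoint k M + (N - M : ℤ) := by
  rw [lt_breakPoint_iff, ← (strictMono_iterate k t j).lt_iff_lt, reflect_eq, two_mul,
    Function.iterate_add_apply]

lemma breakPoint_lt_iterate_iff (t : ℝ) (M N : ℤ) (j : ℕ) :
    breakPoint k N < (rotatedMap k t)^[j] (breakPoint k M) ↔
      breakPoint k M + (N - M : ℤ) < (rotatedMap k t)^[2 * j] (breakPoint k M) := by
  rw [breakPoint_lt_iff, ← (strictMono_iterate k t j).lt_iff_lt, reflect_eq, two_mul,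
    Function.iterate_add_apply]

/-- The analogue for odd times uses the other family of reflections, whose fixed points are the
midpoints `(N + t) / 2`. -/
lemma iterate_succ_lt_half_iff (t : ℝ) (M N : ℤ) (j : ℕ) :
    (rotatedMap k t)^[j + 1] (breakPoint k M) < (N + t) / 2 ↔
      (rotatedMap k t)^[2 * j + 1] (breakPoint k M) < breakPoint k M + (N - M : ℤ) := by
  rw [← iterate_reflect_breakPoint k t M N j, show 2 * j + 1 = j + (j + 1) by ring,
    Function.iterate_add_apply _ j (j + 1), (strictMono_iterate k t j).lt_iff_lt]
  constructor <;> intro h <;> linarith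

lemma iterate_succ_eq_half_iff (t : ℝ) (M N : ℤ) (j : ℕ) :
    (rotatedMap k t)^[j + 1] (breakPoint k M) = (N + t) / 2 ↔
      (rotatedMap k t)^[2 * j + 1] (breakPoint k M) = breakPoint k M + (N - M : ℤ) := by
  rw [← iterate_reflect_breakPoint k t M N j, show 2 * j + 1 = j + (j + 1) by ring,
    Function.iterate_add_apply _ j (j + 1), (strictMono_iterate k t j).injective.eq_iff]
  constructor <;> intro h <;> linarith

/-! ### Dependence on the parameter -/

/-- The last application alone contributes `t' - t`; the earlier ones only help by monotonicity.
Iterates of positive order thus grow with the parameter at rate at least one. -/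
lemma iterate_succ_add_le {t t' : ℝ} (h : t ≤ t') (j : ℕ) (x : ℝ) :
    (rotatedMap k t)^[j + 1] x + (t' - t) ≤ (rotatedMap k t')^[j + 1] x := by
  have hle : rotatedMap k t ≤ rotatedMap k t' := fun y => by
    show rotatedMap k t y ≤ rotatedMap k t' y
    rw [rotatedMap_apply, rotatedMap_apply]; linarith
  have h1 : (rotatedMap k t)^[j] x ≤ (rotatedMap k t')^[j] x :=
    CircleDeg1Lift.iterate_mono hle j x
  have h2 := (strictMono_centredMap k).monotone h1
  rw [Function.iterate_succ_apply', Function.iterate_succ_apply', rotatedMap_apply,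
    rotatedMap_apply]
  linarith

lemma iterate_mono_parameter {t t' : ℝ} (h : t ≤ t') (j : ℕ) (x : ℝ) :
    (rotatedMap k t)^[j] x ≤ (rotatedMap k t')^[j] x := by
  cases j with
  | zero => simp
  | succ j => linarith [iterate_succ_add_le k h j x]

lemma continuous_iterate_parameter (j : ℕ) (x : ℝ) :
    Continuous fun t => (rotatedMap k t)^[j] x := by
  induction j with
  | zero => simpa using continuous_const
  | succ j ih =>
    simp only [Function.iterate_succ_apply', rotatedMap_apply]
    exact ((continuous_centredMap k).comp ih).add continuous_id

/-- The rotation number (of the lift) as a function of the parameter. -/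
noncomputable def rotation (t : ℝ) : ℝ := (rotatedMap k t).translationNumber

lemma monotone_rotation : Monotone (rotation k) := fun t t' h =>
  CircleDeg1Lift.translationNumber_mono fun y => by
    show rotatedMap k t y ≤ rotatedMap k t' y
    rw [rotatedMap_apply, rotatedMap_apply]; linarith

lemma lt_iterate_of_lt_rotation {t : ℝ} {d : ℕ} {n : ℤ} (h : n < d * rotation k t) (x : ℝ) :
    x + n < (rotatedMap k t)^[d] x := by
  by_contra! h2
  exact absurd (iterate_le_imp_translationNumber_le h2) (not_le.2 h)

lemma iterate_lt_of_rotation_lt {t : ℝ} {d : ℕ} {n : ℤ} (h : d * rotation k t < n) (x : ℝ) :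
    (rotatedMap k t)^[d] x < x + n := by
  by_contra! h2
  exact absurd (le_iterate_imp_le_translationNumber h2) (not_le.2 h)

lemma rotation_of_iterate_eq {t : ℝ} {d : ℕ} {n : ℤ} {x : ℝ}
    (h : (rotatedMap k t)^[d] x = x + n) : d * rotation k t = n :=
  le_antisymm (iterate_le_imp_translationNumber_le h.le) (le_iterate_imp_le_translationNumber h.ge)

lemma exists_periodic_parameter {t : ℝ} {d : ℕ} {n : ℤ} (h : n < (d + 1 : ℕ) * rotation k t)
    (x : ℝ) : ∃ r < t, (rotatedMap k r)^[d + 1] x = x + n := by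
  have h0 := lt_iterate_of_lt_rotation k h x
  set g : ℝ → ℝ := fun t => (rotatedMap k t)^[d + 1] x with hg
  -- As `g` grows at rate at least one, lowering `t` by the excess `g t - (x + n)` brings `g` down
  -- to `x + n` or below.
  have hle : t - (g t - (x + n)) ≤ t := by simp only [hg]; linarith
  have h1 : g (t - (g t - (x + n))) ≤ x + n := by
    have := iterate_succ_add_le k hle d x
    simp only [hg] at this ⊢
    linarith
  obtain ⟨r, hr, hr'⟩ := intermediate_value_Icc hle
    (continuous_iterate_parameter k (d + 1) x).continuousOn ⟨h1, h0.le⟩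
  refine ⟨r, lt_of_le_of_ne hr.2 ?_, hr'⟩
  rintro rfl
  exact h0.ne' hr'

/-! ### Affine pieces -/

lemma exists_orbit_affine {t₁ t₂ : ℝ} (M : ℤ) (m : ℕ)
    (h : ∀ j, 1 ≤ j → j ≤ m → ∃ N,
      breakPoint k N ≤ (rotatedMap k t₁)^[j] (breakPoint k M) ∧
        (rotatedMap k t₂)^[j] (breakPoint k M) ≤ breakPoint k (N + 1)) :
    ∃ A B : ℝ, ∀ t ∈ Icc t₁ t₂, (rotatedMap k t)^[m + 1] (breakPoint k M) = A * t + B := by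
  induction m with
  | zero =>
    refine ⟨1, M - breakPoint k M, fun t _ => ?_⟩
    rw [zero_add, Function.iterate_one, rotatedMap_breakPoint]; ring
  | succ m ih =>
    obtain ⟨A, B, hAB⟩ := ih fun j h1 h2 => h j h1 (by omega)
    obtain ⟨N, hN1, hN2⟩ := h (m + 1) (by omega) le_rfl
    obtain ⟨σ, -, hσ⟩ := exists_centredMap_affine k N
    have hmem : ∀ t ∈ Icc t₁ t₂, (rotatedMap k t)^[m + 1] (breakPoint k M) ∈
        Icc (breakPoint k N) (breakPoint k (N + 1)) := fun t ht =>
      ⟨hN1.trans (iterate_mono_parameter k ht.1 _ _),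
        (iterate_mono_parameter k ht.2 _ _).trans hN2⟩
    refine ⟨σ * A + 1, centredMap k (breakPoint k N) + σ * (B - breakPoint k N), fun t ht => ?_⟩
    have h1 := hσ _ (left_mem_Icc.2 (strictMono_breakPoint k (by omega)).le) _ (hmem t ht)
    rw [Function.iterate_succ_apply', rotatedMap_apply]
    rw [hAB t ht] at h1 ⊢
    linarith

lemma exists_iterate_affine (t : ℝ) {c d : ℝ} (m : ℕ)
    (h : ∀ j < m, ∃ N, breakPoint k N ≤ (rotatedMap k t)^[j] c ∧
      (rotatedMap k t)^[j] d ≤ breakPoint k (N + 1)) :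
    ∃ σ > 0, ∀ x ∈ Icc c d, ∀ y ∈ Icc c d,
      (rotatedMap k t)^[m] y - (rotatedMap k t)^[m] x = σ * (y - x) := by
  induction m with
  | zero => exact ⟨1, one_pos, fun x _ y _ => by simp⟩
  | succ m ih =>
    obtain ⟨σ, hσ0, hσ⟩ := ih fun j h1 => h j (by omega)
    obtain ⟨N, hN1, hN2⟩ := h m (by omega)
    obtain ⟨τ, hτ0, hτ⟩ := exists_centredMap_affine k N
    have hmem : ∀ x ∈ Icc c d, (rotatedMap k t)^[m] x ∈
        Icc (breakPoint k N) (breakPoint k (N + 1)) := fun x hx =>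
      ⟨hN1.trans ((strictMono_iterate k t m).monotone hx.1),
        ((strictMono_iterate k t m).monotone hx.2).trans hN2⟩
    refine ⟨τ * σ, mul_pos hτ0 hσ0, fun x hx y hy => ?_⟩
    have h1 := hτ _ (hmem x hx) _ (hmem y hy)
    rw [hσ x hx y hy] at h1
    rw [Function.iterate_succ_apply', Function.iterate_succ_apply', rotatedMap_apply,
      rotatedMap_apply]
    linarith

/-! ### Size of the phase-locking intervals -/

section locking

variable {m i : ℕ} {p p₂ n : ℤ}

lemma iterate_reflect_zero (t : ℝ) (p : ℤ) (m : ℕ) :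
    (rotatedMap k t)^[m] (p + t - (rotatedMap k t)^[m + 1] (breakPoint k 0)) =
      breakPoint k (2 * p) := by
  rw [iterate_reflect_breakPoint, sub_zero, ← breakPoint_add_two_mul, zero_add]

lemma iterate_sub_int (t : ℝ) (j : ℕ) (x : ℝ) (n : ℤ) :
    (rotatedMap k t)^[j] (x - n) = (rotatedMap k t)^[j] x - n := by
  have := iterate_map_add_int (rotatedMap k t) j x (-n)
  push_cast at this
  rw [sub_eq_add_neg, this, ← sub_eq_add_neg]

lemma iterate_left_lt_iff (t : ℝ) (j l : ℕ) (M N n : ℤ) :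
    (rotatedMap k t)^[j] ((rotatedMap k t)^[l] (breakPoint k M) - n) < breakPoint k N ↔
      (rotatedMap k t)^[2 * (j + l)] (breakPoint k M) <
        breakPoint k M + (N + 2 * n - M : ℤ) := by
  rw [← iterate_lt_breakPoint_iff, breakPoint_add_two_mul, iterate_sub_int,
    ← Function.iterate_add_apply, sub_lt_iff_lt_add]

/-- Applying `m` more iterates turns the right side into a break point, and the doubling principle
applies. With `p₂ = p + 2 n - 1` the hypothesis places the rotation number below the Farey mediant
of `p / (2 m + 1)` and `p₂ / (2 i + 1)`. -/
lemma left_lt_reflect {t : ℝ}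
    (h : (2 * (m + (i + 1)) : ℕ) * rotation k t < (2 * p + 2 * n - 1 : ℤ)) :
    (rotatedMap k t)^[i + 1] (breakPoint k 1) - n <
      p + t - (rotatedMap k t)^[m + 1] (breakPoint k 0) := by
  rw [← (strictMono_iterate k t m).lt_iff_lt, iterate_reflect_zero, iterate_left_lt_iff]
  exact iterate_lt_of_rotation_lt k h _

/-- When the orbit of the break point `1` is periodic, the position of an orbit of the break
point `0` in a gap of this periodic orbit. -/
lemma offset_of_periodic {r : ℝ} (hdet : p₂ * (2 * m + 1) - p * (2 * i + 1) = 1)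
    (hn : p₂ = p + 2 * n - 1)
    (hr : (rotatedMap k r)^[2 * m + 1] (breakPoint k 1) = breakPoint k 1 + p) :
    (rotatedMap k r)^[m + 1] (breakPoint k 0) - (p + r) / 2 =
      k * ((p + r) / 2 - ((rotatedMap k r)^[i + 1] (breakPoint k 1) - n)) ∧
    (rotatedMap k r)^[i + 1] (breakPoint k 1) - n < (p + r) / 2 := by
  set Φ := rotatedMap k r with hΦ
  set c := Φ^[i + 1] (breakPoint k 1) - n with hc
  set Z := Φ^[m + 1] (breakPoint k 0) with hZ
  set d := p + r - c with hd
  have hord {a b : ℕ} {N : ℤ} (h : Φ^[a] (breakPoint k 1) + N < Φ^[b] (breakPoint k 1)) :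
      a * p + N * (2 * m + 1) < b * p := by
    exact_mod_cast orbit_lt_imp (strictMono_rotatedMap k r) (by omega) hr h
  have hrot : (2 * m + 1 : ℝ) * rotation k r = p := by
    exact_mod_cast rotation_of_iterate_eq k hr
  have hdetR : (p₂ * (2 * m + 1) - p * (2 * i + 1) : ℝ) = 1 := by exact_mod_cast hdet
  have hnR : (p₂ : ℝ) = p + 2 * n - 1 := by rw [hn]; push_cast; ring
  have hmpos : (0 : ℝ) < 2 * m + 1 := by positivity
  -- The points `c` and `d = p + r - c` are the ends of a gap of the periodic orbit, symmetric about
  -- `(p + r) / 2`.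
  have hcm : c < (p + r) / 2 := by
    have : Φ^[i + 1] (breakPoint k 1) < ((p + 2 * n : ℤ) + r) / 2 := by
      rw [iterate_succ_lt_half_iff]
      refine iterate_lt_of_rotation_lt k ?_ _
      rw [← mul_lt_mul_iff_right₀ hmpos]
      push_cast
      nlinarith
    push_cast at this
    rw [hc]; linarith
  have hcz : c < p + r - Z := by
    refine left_lt_reflect k ?_
    rw [← mul_lt_mul_iff_right₀ hmpos]
    push_cast
    nlinarith
  have hzQ : Φ^[m] (p + r - Z) = breakPoint k (2 * p) := iterate_reflect_zero k r p m
  have hid : Φ^[i] d = breakPoint k 1 + (p + n - 1 : ℤ) := by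
    have := iterate_reflect_breakPoint k r 1 (p + n) i
    rw [← this, hd, hc]
    push_cast
    congr 1; ring
  have hdper : Φ^[2 * m + 1] d = d + p := by
    apply (strictMono_iterate k r i).injective
    rw [← Function.iterate_add_apply, add_comm, Function.iterate_add_apply, hid,
      iterate_map_add_int, iterate_map_add_int, hr, hid]
    ring
  -- The involution fixing `breakPoint k (2 * p)` swaps the images of the two ends of the gap.
  have he : Φ^[m] d = 2 * p - centredMap k (Φ^[m] c) := by
    apply (strictMono_iterate k r (m + 1)).injective
    have h1 := iterate_reversal k r (2 * p) (m + 1) c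
    rw [← Function.iterate_add_apply, show m + 1 + m = 2 * m + 1 by ring, ← hΦ, hdper]
    rw [Function.iterate_succ_apply' _ m c, rotatedMap_apply] at h1
    push_cast at h1
    rw [show 2 * (p : ℝ) - centredMap k (Φ^[m] c) =
      2 * p + r - (centredMap k (Φ^[m] c) + r) by ring, h1, hd]
    ring
  have hcQ : Φ^[m] c < breakPoint k (2 * p) := by
    rw [← hzQ]; exact strictMono_iterate k r m hcz
  have hcQ' : breakPoint k (2 * p - 1) ≤ Φ^[m] c := by
    by_contra! h
    rw [hc, iterate_left_lt_iff] at h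
    have h2 := hord (a := 2 * (m + (i + 1))) (b := 0) (N := -(2 * p - 1 + 2 * n - 1))
      (by push_cast at h ⊢; simp only [Function.iterate_zero, id]; linarith)
    push_cast at h2
    have : (0 : ℤ) ≤ m := by positivity
    nlinarith
  have hzd : p + r - Z < d := by
    rw [← (strictMono_iterate k r m).lt_iff_lt, hzQ, he]
    have := strictMono_centredMap k hcQ
    rw [centredMap_breakPoint] at this
    push_cast at this
    linarith
  -- No break point lies inside the image of the gap before time `m`, so the first `m` iterates act
  -- on the gap as one affine map.
  obtain ⟨σ, hσ0, hσ⟩ := exists_iterate_affine k r (c := c) (d := d) m fun j hj => by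
    obtain ⟨N, hN1, hN2⟩ := exists_breakPoint_le_lt k (Φ^[j] c)
    refine ⟨N, hN1, ?_⟩
    by_contra! hN3
    rw [hc, iterate_left_lt_iff] at hN2
    have h1 := hord (a := 2 * (j + (i + 1))) (b := 0) (N := -(N + 1 + 2 * n - 1))
      (by push_cast at hN2 ⊢; simp only [Function.iterate_zero, id]; linarith)
    have h2 : c + (N + 1 - p : ℤ) < Φ^[2 * j + 1] d := by
      rw [breakPoint_lt_iff, ← (strictMono_iterate k r (j + 1)).lt_iff_lt] at hN3
      have h3 := iterate_reversal k r (N + 1) (j + 1) d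
      rw [Function.iterate_succ_apply' _ j d, rotatedMap_apply] at h3
      rw [← Function.iterate_add_apply, show j + 1 + j = 2 * j + 1 by ring,
        show ((N + 1 : ℤ) : ℝ) - centredMap k ((rotatedMap k r)^[j] d) =
          ((N + 1 : ℤ) : ℝ) + r - (centredMap k ((rotatedMap k r)^[j] d) + r) by ring, h3] at hN3
      rw [← hΦ] at hN3
      refine lt_of_eq_of_lt ?_ hN3
      rw [hd]; push_cast; ring
    rw [← (strictMono_iterate k r i).lt_iff_lt, ← Function.iterate_add_apply, add_comm i,
      Function.iterate_add_apply, ← hΦ, hid, iterate_map_add_int,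
      iterate_map_add_int, hc, iterate_sub_int, ← Function.iterate_add_apply] at h2
    have h3 := hord (a := i + (i + 1)) (b := 2 * j + 1) (N := N + 2 - 2 * p - 2 * n)
      (by push_cast at h2 ⊢; linarith)
    push_cast at h1 h3
    -- By the determinant relation, `h1` and `h3` bound the left side strictly within one of the
    -- right side, so integrality forces equality. Coprimality then gives `2 m + 1 ∣ 2 j + 1`,
    -- impossible for `j < m`.
    have h4 : (2 * j + 1 : ℤ) * p = (N + 1 - p) * (2 * m + 1) := by
      subst hn
      apply le_antisymm
      · rw [← Int.lt_add_one_iff]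
        linarith
      · rw [← Int.lt_add_one_iff]
        linarith
    have h5 : (2 * m + 1 : ℤ) ∣ 2 * j + 1 := by
      refine ⟨(2 * j + 1) * p₂ - (N + 1 - p) * (2 * i + 1), ?_⟩
      linear_combination (-(2 * j + 1 : ℤ)) * hdet - (2 * i + 1 : ℤ) * h4
    have := Int.le_of_dvd (by positivity) h5
    omega
  have e1 := hσ c ⟨le_rfl, (hcz.trans hzd).le⟩ (p + r - Z) ⟨hcz.le, hzd.le⟩
  have e2 := hσ (p + r - Z) ⟨hcz.le, hzd.le⟩ d ⟨(hcz.trans hzd).le, le_rfl⟩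
  have e3 := centredMap_sub_of_odd k p ⟨hcQ', hcQ.le⟩
    ⟨(strictMono_breakPoint k (by omega)).le, le_rfl⟩
  rw [centredMap_breakPoint] at e3
  rw [hzQ] at e1 e2
  rw [he] at e2
  push_cast at e3
  -- At time `m` the break point divides the image gap in the ratio `1 : slope k`, because the
  -- involution swapping the ends has slope `-slope k` on the left part. The affine iterate pulls
  -- this ratio back to the original gap.
  have e4 : d - (p + r - Z) = slope k * (p + r - Z - c) := by
    apply mul_left_cancel₀ hσ0.ne'
    rw [← e2]
    linear_combination e3 + slope k * e1
  refine ⟨?_, hcm⟩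
  rw [slope] at e4
  have hk : (1 : ℝ) - k ≠ 0 := by linarith [k.2.2]
  field_simp at e4
  rw [hd] at e4
  linear_combination e4 / 2

/-- The first `m` iterates of a break point do not cross break points while the rotation number
stays between Farey neighbours with denominators `2 * m + 1` and `2 * i + 1`. -/
lemma exists_piece_of_rotation {r t : ℝ} (hdet : p₂ * (2 * m + 1) - p * (2 * i + 1) = 1)
    (hr : (2 * m + 1) * rotation k r = p) (h3 : (2 * i + 1) * rotation k t < p₂)
    {j : ℕ} (hj1 : 1 ≤ j) (hj2 : j ≤ m) :
    ∃ N, breakPoint k N ≤ (rotatedMap k r)^[j] (breakPoint k 0) ∧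
      (rotatedMap k t)^[j] (breakPoint k 0) ≤ breakPoint k (N + 1) := by
  obtain ⟨N, hN1, hN2⟩ := exists_breakPoint_le_lt k ((rotatedMap k r)^[j] (breakPoint k 0))
  refine ⟨N, hN1, ?_⟩
  by_contra! hN3
  rw [iterate_lt_breakPoint_iff] at hN2
  rw [breakPoint_lt_iterate_iff] at hN3
  have a1 : (2 * j : ℕ) * rotation k r ≤ _ := iterate_le_imp_translationNumber_le hN2.le
  have a2 : _ ≤ (2 * j : ℕ) * rotation k t := le_iterate_imp_le_translationNumber hN3.le
  push_cast at a1 a2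
  have hj0 : (0 : ℝ) < 2 * j := by
    have : (1 : ℝ) ≤ j := by exact_mod_cast hj1
    linarith
  have b1 : p * (2 * j) ≤ (N + 1) * (2 * m + 1) := by
    have : (p * (2 * j) : ℝ) ≤ (N + 1) * (2 * m + 1) := by
      have hmpos : (0 : ℝ) < 2 * m + 1 := by positivity
      rw [← hr]
      calc (2 * m + 1) * rotation k r * (2 * j) = (2 * m + 1) * (2 * j * rotation k r) := by ring
        _ ≤ (2 * m + 1) * (N + 1) := mul_le_mul_of_nonneg_left (by linarith) hmpos.le
        _ = _ := by ring
    exact_mod_cast this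
  have b2 : (N + 1) * (2 * i + 1) < 2 * j * p₂ := by
    have hi : (0 : ℝ) < 2 * i + 1 := by positivity
    have : ((N + 1) * (2 * i + 1) : ℝ) < 2 * j * p₂ := by nlinarith
    exact_mod_cast this
  have hi : (0 : ℤ) ≤ i := by positivity
  have hm : (0 : ℤ) ≤ m := by positivity
  -- A fraction from the Farey interval, right end excluded, is a nonnegative integer combination of
  -- its ends. The left end enters with positive weight, so the denominator is at least `2 m + 1`.
  have b3 : (2 * j : ℤ) = (2 * m + 1) * (2 * j * p₂ - (N + 1) * (2 * i + 1)) +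
      (2 * i + 1) * ((N + 1) * (2 * m + 1) - p * (2 * j)) := by
    linear_combination (-(2 * j : ℤ)) * hdet
  have b4 : (2 * j : ℤ) ≥ 2 * m + 1 := by nlinarith
  omega

/-- Below a parameter `t` whose rotation number is slightly larger than `p / (2 m + 1)`, a
definite proportion of parameters has the rotation number `p / (2 m + 1)`. -/
theorem exists_locking_interval {t : ℝ} (hdet : p₂ * (2 * m + 1) - p * (2 * i + 1) = 1)
    (h1 : p < (2 * m + 1) * rotation k t)
    (h2 : (2 * m + 1 + (2 * i + 1)) * rotation k t < p + p₂) :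
    ∃ r₁ r₂, r₁ < t ∧ r₂ ≤ t ∧ k * (t - r₁) ≤ r₂ - r₁ ∧
      ∀ s ∈ Icc r₁ r₂, (2 * m + 1) * rotation k s = p := by
  -- Both denominators being odd, the determinant relation makes `p₂ - p` odd.
  obtain ⟨n, hn⟩ : ∃ n, p₂ = p + 2 * n - 1 := ⟨1 - p₂ * m + p * i, by linear_combination hdet⟩
  obtain ⟨r₁, hr₁, hper₁⟩ := exists_periodic_parameter k (d := 2 * m) (n := p) (t := t)
    (by push_cast; exact h1) (breakPoint k 0)
  obtain ⟨r₂, hr₂, hper₂⟩ := exists_periodic_parameter k (d := 2 * m) (n := p) (t := t)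
    (by push_cast; exact h1) (breakPoint k 1)
  have hrot₁ : (2 * m + 1) * rotation k r₁ = p := by
    exact_mod_cast rotation_of_iterate_eq k hper₁
  have hrot₂ : (2 * m + 1) * rotation k r₂ = p := by
    exact_mod_cast rotation_of_iterate_eq k hper₂
  have hmpos : (0 : ℝ) < 2 * m + 1 := by positivity
  have hdetR : (p₂ * (2 * m + 1) - p * (2 * i + 1) : ℝ) = 1 := by exact_mod_cast hdet
  have hnR : (p₂ : ℝ) = p + 2 * n - 1 := by rw [hn]; push_cast; ring
  obtain ⟨e1, e2⟩ := offset_of_periodic k hdet hn hper₂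
  have e3 : (rotatedMap k r₁)^[m + 1] (breakPoint k 0) = (p + r₁) / 2 := by
    rw [iterate_succ_eq_half_iff, hper₁, sub_zero]
  have e4 := (left_lt_reflect k (m := m) (i := i) (p := p) (n := n) (t := t)
    (by push_cast; linarith)).le
  have e5 := iterate_succ_add_le k hr₂.le i (breakPoint k 1)
  have hkpos := k.2.1
  have hlt : r₁ < r₂ := by
    by_contra! hle
    have := iterate_succ_add_le k hle m (breakPoint k 0)
    have := mul_pos hkpos (sub_pos.2 e2)
    linarith
  -- The offset of the iterate of `breakPoint k 0` from the midpoint `(p + s) / 2` is affine in `s ∈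
  -- [r₁, t]`, with slope `A - 1 / 2`.
  obtain ⟨A, B, hAB⟩ := exists_orbit_affine k (t₁ := r₁) (t₂ := t) 0 m fun j hj1 hj2 =>
    exists_piece_of_rotation k hdet hrot₁ (by linarith) hj1 hj2
  rw [hAB r₁ ⟨le_rfl, hr₁.le⟩] at e3
  rw [hAB r₂ ⟨hlt.le, hr₂.le⟩] at e1
  rw [hAB t ⟨hr₁.le, le_rfl⟩] at e4
  refine ⟨r₁, r₂, hr₁, hr₂.le, ?_, fun s hs => ?_⟩
  · set κ := (p + r₂) / 2 - ((rotatedMap k r₂)^[i + 1] (breakPoint k 1) - n) with hκ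
    have hκ0 : 0 < κ := by linarith
    have f1 : (A - 1 / 2) * (r₂ - r₁) = k * κ := by linarith
    -- By `e4` the offset at `t` is at most the half-gap at `t`. This is at most `κ`, since the left
    -- end moves at speed at least one and the midpoint at speed one half.
    have f2 : (A - 1 / 2) * (t - r₁) ≤ κ := by linarith
    have f3 : 0 < A - 1 / 2 := by
      by_contra! h
      have := mul_pos hkpos hκ0
      have := mul_nonpos_of_nonpos_of_nonneg h (sub_pos.2 hlt).le
      linarith
    refine le_of_mul_le_mul_left ?_ f3
    rw [f1, mul_left_comm]
    exact mul_le_mul_of_nonneg_left f2 hkpos.le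
  · have g1 := monotone_rotation k hs.1
    have g2 := monotone_rotation k hs.2
    have g3 : rotation k r₁ = rotation k r₂ := by
      apply mul_left_cancel₀ hmpos.ne'
      rw [hrot₁, hrot₂]
    rw [← hrot₁, le_antisymm (g3 ▸ g2) g1]

end locking

/-! ### Farey neighbours with odd denominators. -/

/-- An irrational number lies between Farey neighbours with arbitrarily large odd denominators. -/
lemma exists_odd_farey {ρ : ℝ} (hρ : Irrational ρ) (n : ℕ) : ∃ (m i : ℕ) (p₁ p₂ : ℤ),
    p₂ * (2 * m + 1) - p₁ * (2 * i + 1) = 1 ∧ p₁ < (2 * m + 1) * ρ ∧ (2 * i + 1) * ρ < p₂ ∧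
      n ≤ m + i := by
  have hne (q : ℕ) (p : ℤ) : (2 * q + 1) * ρ - p ≠ 0 := by
    have h := (hρ.natCast_mul (m := 2 * q + 1) (by omega)).ne_int p
    push_cast at h
    exact sub_ne_zero.2 h
  induction n with
  | zero =>
    have h := hne 0 ⌊ρ⌋
    have h1 := Int.floor_le ρ
    refine ⟨0, 0, ⌊ρ⌋, ⌊ρ⌋ + 1, by push_cast; ring, ?_, ?_, le_rfl⟩
    · push_cast at h ⊢
      exact lt_of_le_of_ne (by linarith) fun e => h (by linarith)
    · push_cast
      linarith [Int.lt_floor_add_one ρ]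
  | succ n ih =>
    obtain ⟨m, i, p₁, p₂, hdet, h1, h2, hn⟩ := ih
    set u := (2 * m + 1) * ρ - p₁ with hu
    set v := p₂ - (2 * i + 1) * ρ with hv
    have hu0 : 0 < u := by linarith
    have hv0 : 0 < v := by linarith
    have huv : u - v ≠ 0 := by
      have h := (hρ.natCast_mul (m := 2 * (m + i + 1)) (by omega)).ne_int (p₁ + p₂)
      push_cast at h
      intro e
      exact h (by linarith)
    have hfloor {x V : ℝ} (hx : 0 < x) (hV : 0 < V) (hx' : ∀ a : ℕ, x - a * V ≠ 0) :
        ∃ a : ℕ, 0 < x - a * V ∧ x - (a + 1) * V < 0 := by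
      refine ⟨⌊x / V⌋₊, lt_of_le_of_ne ?_ (hx' _).symm, ?_⟩
      · have := (le_div_iff₀ hV).1 (Nat.floor_le (div_pos hx hV).le)
        linarith
      · have := (div_lt_iff₀ hV).1 (Nat.lt_floor_add_one (x / V))
        linarith
    -- The sign of `u - v` tells on which side of the mediant `ρ` lies. The mediant has even
    -- denominator, so adding multiples of it to the surviving end keeps denominators odd; `ρ` lies
    -- between two consecutive such fractions.
    rcases lt_or_gt_of_ne huv with h | h
    · obtain ⟨a, ha1, ha2⟩ := hfloor (x := u) (V := v - u) hu0 (by linarith) fun a e =>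
        hne (m + a * (m + i + 1)) (p₁ + a * (p₁ + p₂)) (by push_cast; linarith)
      refine ⟨m + a * (m + i + 1), m + (a + 1) * (m + i + 1), p₁ + a * (p₁ + p₂),
        p₁ + (a + 1) * (p₁ + p₂), ?_, ?_, ?_, ?_⟩
      · push_cast
        linear_combination hdet
      · push_cast; linarith
      · push_cast; linarith
      · nlinarith [Nat.zero_le (a * (m + i + 1))]
    · obtain ⟨a, ha1, ha2⟩ := hfloor (x := v) (V := u - v) hv0 h fun a e =>
        hne (i + a * (m + i + 1)) (p₂ + a * (p₁ + p₂)) (by push_cast; linarith)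
      refine ⟨i + (a + 1) * (m + i + 1), i + a * (m + i + 1), p₂ + (a + 1) * (p₁ + p₂),
        p₂ + a * (p₁ + p₂), ?_, ?_, ?_, ?_⟩
      · push_cast
        linear_combination hdet
      · push_cast; linarith
      · push_cast; linarith
      · nlinarith [Nat.zero_le (a * (m + i + 1))]

/-! ### Reflection of the parameter and strict monotonicity at irrational rotation numbers. -/

lemma neg_iterate_neg (t x : ℝ) (n : ℕ) :
    (rotatedMap k (-t))^[n] (x + 1 / 2) = 1 / 2 - (rotatedMap k t)^[n] (-x) := by
  induction n with
  | zero => simp; ring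
  | succ n ih =>
    rw [Function.iterate_succ_apply', Function.iterate_succ_apply', ih, rotatedMap_apply,
      rotatedMap_apply, sub_eq_neg_add, centredMap_add_half, neg_neg]
    ring

lemma rotation_neg (t : ℝ) : rotation k (-t) = -rotation k t := by
  have h1 := (rotatedMap k (-t)).tendsto_translationNumber (1 / 2)
  have h2 := ((rotatedMap k t).tendsto_translationNumber 0).neg
  refine tendsto_nhds_unique h1 (h2.congr fun n => ?_)
  have := neg_iterate_neg k t 0 n
  rw [zero_add, neg_zero] at this
  rw [CircleDeg1Lift.coe_pow, CircleDeg1Lift.coe_pow, this]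
  ring

lemma exists_iterate_eq_add (t : ℝ) (q : ℕ) :
    ∃ x, (rotatedMap k t)^[q] x = x + q * rotation k t := by
  obtain ⟨x, hx⟩ := ((rotatedMap k t) ^ q).exists_eq_add_translationNumber
    (CircleDeg1Lift.continuous_pow _ (continuous_rotatedMap k t) q)
  rw [CircleDeg1Lift.translationNumber_pow, CircleDeg1Lift.coe_pow] at hx
  exact ⟨x, hx⟩

/-- The rotation number is strictly increasing at irrational values. -/
lemma rotation_lt_of_irrational {s t : ℝ} (h : s < t) (ht : Irrational (rotation k t)) :
    rotation k s < rotation k t := by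
  refine lt_of_le_of_ne (monotone_rotation k h.le) fun heq => ?_
  obtain ⟨n, hn⟩ := exists_nat_one_div_lt (sub_pos.2 h)
  -- With constant rotation number on `[s, t]`, moving the parameter across this interval shifts a
  -- `q`-th iterate by at least `t - s`, which carries it across the translation by the Dirichlet
  -- approximant `p`.
  obtain ⟨p, q, hq0, -, hpq⟩ :=
    Real.exists_int_int_abs_mul_sub_le (rotation k t) (n := n + 1) (by omega)
  have hlt : |q * rotation k t - p| < t - s := by
    refine (hpq.trans ?_).trans_lt hn
    push_cast
    exact one_div_le_one_div_of_le (by positivity) (by linarith)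
  obtain ⟨l, rfl⟩ : ∃ l : ℕ, q = (l + 1 : ℕ) := ⟨(q - 1).toNat, by push_cast; omega⟩
  have hne : ((l + 1 : ℕ) : ℝ) * rotation k t ≠ p := (ht.natCast_mul (by omega)).ne_int p
  push_cast at hlt hne
  rw [abs_lt] at hlt
  rcases lt_or_gt_of_ne hne with h1 | h1
  · obtain ⟨x, hx⟩ := exists_iterate_eq_add k s (l + 1)
    have h2 := iterate_succ_add_le k h.le l x
    have h3 : ((l + 1 : ℕ) : ℝ) * rotation k t < p := by push_cast; exact h1
    have h4 := iterate_lt_of_rotation_lt k h3 x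
    rw [hx, heq] at h2
    push_cast at h2
    linarith
  · obtain ⟨x, hx⟩ := exists_iterate_eq_add k t (l + 1)
    have h2 := iterate_succ_add_le k h.le l x
    have h3 : (p : ℝ) < ((l + 1 : ℕ) : ℝ) * rotation k s := by rw [heq]; push_cast; exact h1
    have h4 := lt_iterate_of_lt_rotation k h3 x
    rw [hx] at h2
    push_cast at h2
    linarith

lemma not_irrational_of_mul_eq {m : ℕ} {p : ℤ} {x : ℝ} (h : (2 * m + 1) * x = p) :
    ¬ Irrational x := fun hx => by
  have := (hx.natCast_mul (m := 2 * m + 1) (by omega)).ne_int p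
  push_cast at this
  exact this h

/-- Farey neighbours bound the excess of the rotation number at `t` over `p / (2 m + 1)` by `1 / ((2
m + 1) (2 i + 1))`. By `h3` this is less than the drop over `[t - ε, t]`, so the locking interval
starts after `t - ε`. -/
lemma exists_rational_piece_left {t ε : ℝ} {m i : ℕ} {p p₂ : ℤ}
    (hdet : p₂ * (2 * m + 1) - p * (2 * i + 1) = 1) (h1 : p < (2 * m + 1) * rotation k t)
    (h2 : (2 * m + 1 + (2 * i + 1)) * rotation k t < p + p₂)
    (h3 : 1 < (m + i + 1) * (rotation k t - rotation k (t - ε))) :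
    ∃ r₁ r₂, t - ε < r₁ ∧ r₁ < t ∧ r₂ ≤ t ∧ k * (t - r₁) ≤ r₂ - r₁ ∧
      ∀ s ∈ Icc r₁ r₂, ¬ Irrational (rotation k s) := by
  obtain ⟨r₁, r₂, a1, a2, a3, a4⟩ := exists_locking_interval k hdet h1 h2
  refine ⟨r₁, r₂, ?_, a1, a2, a3, fun s hs => not_irrational_of_mul_eq (a4 s hs)⟩
  have h5 : r₁ ≤ r₂ := by
    have := mul_pos k.2.1 (sub_pos.2 a1)
    linarith
  have h4 := a4 r₁ ⟨le_rfl, h5⟩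
  refine (monotone_rotation k).reflect_lt ?_
  have hdetR : (p₂ * (2 * m + 1) - p * (2 * i + 1) : ℝ) = 1 := by exact_mod_cast hdet
  by_contra! hle
  have hm : (0 : ℝ) ≤ m := by positivity
  have hi : (0 : ℝ) ≤ i := by positivity
  have b1 : (2 * i + 1) * ((2 * m + 1) * rotation k t - p) < 1 := by
    have : (2 * m + 1) * ((2 * i + 1) * rotation k t) < (2 * m + 1) * p₂ :=
      mul_lt_mul_of_pos_left (by linarith) (by positivity)
    linarith
  have b2 : rotation k t - rotation k (t - ε) ≤ rotation k t - rotation k r₁ := by linarith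
  have b3 : 0 < rotation k t - rotation k r₁ := by
    have : 0 < (2 * m + 1) * (rotation k t - rotation k r₁) := by rw [mul_sub, h4]; linarith
    exact pos_of_mul_pos_right this (by positivity)
  have b4 : (m + i + 1) * (rotation k t - rotation k (t - ε)) ≤
      (2 * i + 1) * ((2 * m + 1) * (rotation k t - rotation k r₁)) := by
    calc _ ≤ (m + i + 1) * (rotation k t - rotation k r₁) :=
          mul_le_mul_of_nonneg_left b2 (by positivity)
      _ ≤ ((2 * i + 1) * (2 * m + 1)) * (rotation k t - rotation k r₁) :=
          mul_le_mul_of_nonneg_right (by nlinarith [mul_nonneg hm hi]) b3.le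
      _ = _ := by ring
  rw [mul_sub (2 * (m : ℝ) + 1), h4] at b4
  linarith

lemma exists_rational_piece {t ε : ℝ} (ht : Irrational (rotation k t)) (hε : 0 < ε) :
    ∃ a b c d, a ≤ t ∧ t ≤ b ∧ 0 < b - a ∧ b - a < ε ∧ a ≤ c ∧ d ≤ b ∧ k * (b - a) ≤ d - c ∧
      ∀ s ∈ Icc c d, ¬ Irrational (rotation k s) := by
  have hl := rotation_lt_of_irrational k (show t - ε < t by linarith) ht
  have hr := rotation_lt_of_irrational k (s := -t - ε) (t := -t) (by linarith)
    (by rw [rotation_neg]; exact ht.neg)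
  obtain ⟨n, hn⟩ := exists_nat_gt (1 / min (rotation k t - rotation k (t - ε))
    (rotation k (-t) - rotation k (-t - ε)))
  obtain ⟨m, i, p₁, p₂, hdet, h1, h2, hmi⟩ := exists_odd_farey ht n
  have hmin : 0 < min (rotation k t - rotation k (t - ε)) (rotation k (-t) - rotation k (-t - ε)) :=
    lt_min (sub_pos.2 hl) (sub_pos.2 hr)
  have h3 : 1 < (m + i + 1 : ℝ) * min (rotation k t - rotation k (t - ε))
      (rotation k (-t) - rotation k (-t - ε)) := by
    rw [← div_lt_iff₀ hmin]
    have : (n : ℝ) ≤ m + i := by exact_mod_cast hmi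
    linarith
  have hpos : (0 : ℝ) ≤ m + i + 1 := by positivity
  have hne : (2 * m + 1 + (2 * i + 1)) * rotation k t ≠ p₁ + p₂ := by
    have := (ht.natCast_mul (m := 2 * m + 1 + (2 * i + 1)) (by omega)).ne_int (p₁ + p₂)
    push_cast at this
    exact this
  -- Below the mediant the locking interval is found to the left of `t`; above it, the same argument
  -- at `-t` gives one to the right.
  rcases lt_or_gt_of_ne hne with h | h
  · obtain ⟨r₁, r₂, a1, a2, a3, a4, a5⟩ := exists_rational_piece_left k hdet h1 h
      (h3.trans_le (mul_le_mul_of_nonneg_left (min_le_left _ _) hpos))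
    exact ⟨r₁, t, r₁, r₂, a2.le, le_rfl, by linarith, by linarith, le_rfl, a3, a4, a5⟩
  · obtain ⟨r₁, r₂, a1, a2, a3, a4, a5⟩ := exists_rational_piece_left k (t := -t) (ε := ε)
      (m := i) (i := m) (p := -p₂) (p₂ := -p₁)
      (by linear_combination hdet) (by rw [rotation_neg]; push_cast; linarith)
      (by rw [rotation_neg]; push_cast; linarith)
      (by rw [add_comm (i : ℝ)]
          exact h3.trans_le (mul_le_mul_of_nonneg_left (min_le_right _ _) hpos))
    refine ⟨t, -r₁, -r₂, -r₁, le_rfl, by linarith, by linarith, by linarith, by linarith, le_rfl,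
      by linarith, fun s hs => ?_⟩
    have := a5 (-s) ⟨by linarith [hs.2], by linarith [hs.1]⟩
    rwa [rotation_neg, irrational_neg_iff] at this

/-- The set of parameters with irrational rotation number has measure zero. -/
theorem volume_irrational_rotation : volume {t | Irrational (rotation k t)} = 0 := by
  set E := {t | Irrational (rotation k t)} with hE
  suffices h : ∀ x ∈ E, ¬ ∀ (w δ : ℕ → ℝ) (_ : Tendsto δ atTop (𝓝[>] 0))
      (_ : ∀ᶠ j in atTop, x ∈ Metric.closedBall (w j) (1 * δ j)),
      Tendsto (fun j => volume (E ∩ Metric.closedBall (w j) (δ j)) /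
        volume (Metric.closedBall (w j) (δ j))) atTop (𝓝 1) by
    rw [← Measure.restrict_apply_self]
    refine measure_mono_null h (ae_iff.1 ?_)
    exact (IsUnifLocDoublingMeasure.ae_tendsto_measure_inter_div
      (volume : Measure ℝ) E 1).mono fun x hx w δ h₁ h₂ => hx w δ h₁ h₂
  intro t ht hden
  choose a b c d h1 h2 h3 h4 h5 h6 h7 h8 using fun n : ℕ =>
    exists_rational_piece k (t := t) (ε := 1 / ((n : ℝ) + 1)) ht (by positivity)
  have hball (n : ℕ) : Metric.closedBall ((a n + b n) / 2) ((b n - a n) / 2) = Icc (a n) (b n) := by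
    rw [Real.closedBall_eq_Icc]; congr 1 <;> ring
  have hlim : Tendsto (fun n => (b n - a n) / 2) atTop (𝓝[>] 0) := by
    refine tendsto_nhdsWithin_iff.2 ⟨?_, Eventually.of_forall fun n => half_pos (h3 n)⟩
    refine squeeze_zero (fun n => (half_pos (h3 n)).le) (fun n => ?_)
      tendsto_one_div_add_atTop_nhds_zero_nat
    linarith [h3 n, h4 n]
  -- The density theorem is used for balls containing `t` but not centred there, as `t` is an
  -- endpoint of each interval. The locked proportion `k` keeps the density at most `1 - k`.
  have hT := hden (fun n => (a n + b n) / 2) (fun n => (b n - a n) / 2) hlim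
    (Eventually.of_forall fun n => by rw [one_mul, hball]; exact ⟨h1 n, h2 n⟩)
  have hle : (1 : ENNReal) ≤ ENNReal.ofReal (1 - k) := by
    refine le_of_tendsto' hT fun n => ?_
    rw [hball, Real.volume_Icc]
    refine ENNReal.div_le_of_le_mul ?_
    have hsub : E ∩ Icc (a n) (b n) ⊆ Icc (a n) (b n) \ Icc (c n) (d n) := fun s hs =>
      ⟨hs.2, fun hs' => h8 n s hs' hs.1⟩
    have hcd : c n ≤ d n := by
      have := mul_pos k.2.1 (h3 n)
      linarith [h7 n]
    refine (measure_mono hsub).trans ?_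
    rw [measure_sdiff (Icc_subset_Icc (h5 n) (h6 n)) measurableSet_Icc.nullMeasurableSet
      (by rw [Real.volume_Icc]; exact ENNReal.ofReal_ne_top), Real.volume_Icc, Real.volume_Icc,
      ← ENNReal.ofReal_sub _ (sub_nonneg.2 hcd), ← ENNReal.ofReal_mul (by linarith [k.2.2])]
    exact ENNReal.ofReal_le_ofReal (by linarith [h7 n])
  rw [ENNReal.one_le_ofReal] at hle
  linarith [k.2.1]

/-! ### The flow -/

lemma upperBoundary_sub_le {ℓ α : ℝ} (hα : 0 ≤ Real.tan α) (x y : ℝ) :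
    upperBoundary ℓ α x - upperBoundary ℓ α y ≤ Real.tan α * |x - y| := by
  have := abs_sub_abs_le_abs_sub y x
  rw [abs_sub_comm y x] at this
  unfold upperBoundary
  nlinarith

lemma upperBoundary_neg (ℓ α x : ℝ) : upperBoundary ℓ α (-x) = upperBoundary ℓ α x := by
  rw [upperBoundary, abs_neg, upperBoundary]

lemma upperBoundary_half (ℓ α : ℝ) : upperBoundary ℓ α (1 / 2) = upperBoundary ℓ α (-(1 / 2)) :=
  (upperBoundary_neg ℓ α (1 / 2)).symm

/-- Hypotheses on a trapezoid and a direction. -/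
structure Admissible (ℓ α θ : ℝ) : Prop where
  base_pos : 0 < ℓ
  angle_pos : 0 < α
  angle_lt : α < θ
  lt_pi_div_two : θ < Real.pi / 2

namespace Admissible

variable {ℓ α θ : ℝ}

lemma cos_pos (H : Admissible ℓ α θ) : 0 < Real.cos θ :=
  Real.cos_pos_of_mem_Ioo ⟨by linarith [H.angle_pos, H.angle_lt, Real.pi_pos], H.lt_pi_div_two⟩

lemma sin_pos (H : Admissible ℓ α θ) : 0 < Real.sin θ :=
  Real.sin_pos_of_pos_of_lt_pi (by linarith [H.angle_pos, H.angle_lt])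
    (by linarith [H.lt_pi_div_two, Real.pi_pos])

lemma tan_pos (H : Admissible ℓ α θ) : 0 < Real.tan α :=
  Real.tan_pos_of_pos_of_lt_pi_div_two H.angle_pos (H.angle_lt.trans H.lt_pi_div_two)

lemma tan_mul_cos_lt (H : Admissible ℓ α θ) : Real.tan α * Real.cos θ < Real.sin θ := by
  have h := Real.tan_lt_tan_of_lt_of_lt_pi_div_two (by linarith [H.angle_pos, Real.pi_pos])
    H.lt_pi_div_two H.angle_lt
  rw [Real.tan_eq_sin_div_cos θ, lt_div_iff₀ H.cos_pos] at h
  exact h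

lemma upperBoundary_pos (H : Admissible ℓ α θ) {x : ℝ} (hx : |x| ≤ 1 / 2) :
    0 < upperBoundary ℓ α x := by
  have := mul_nonneg H.tan_pos.le (sub_nonneg.2 hx)
  have := H.base_pos
  unfold upperBoundary
  linarith

lemma upperBoundary_sub_lt (H : Admissible ℓ α θ) {x y : ℝ} {s : ℝ} (hs : 0 < s)
    (h : |x - y| = s * Real.cos θ) :
    upperBoundary ℓ α x - upperBoundary ℓ α y < s * Real.sin θ := by
  have h1 := upperBoundary_sub_le (ℓ := ℓ) H.tan_pos.le x y
  have h2 := mul_lt_mul_of_pos_left H.tan_mul_cos_lt hs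
  rw [h] at h1
  linarith

lemma upperBoundary_sub_le' (H : Admissible ℓ α θ) {x y : ℝ} {s : ℝ} (hs : 0 ≤ s)
    (h : |x - y| = s * Real.cos θ) :
    upperBoundary ℓ α x - upperBoundary ℓ α y ≤ s * Real.sin θ := by
  have h1 := upperBoundary_sub_le (ℓ := ℓ) H.tan_pos.le x y
  have h2 := mul_le_mul_of_nonneg_left H.tan_mul_cos_lt.le hs
  rw [h] at h1
  linarith

end Admissible

open Classical in
/-- The representative of a point of the surface which lies neither on the right side nor on the
upper side. -/
noncomputable def tableNormalForm (ℓ α : ℝ) (p : unfoldedTable ℓ α) : ℝ × ℝ :=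
  (if p.1.1 = 1 / 2 then -(1 / 2) else p.1.1,
    if p.1.2 = upperBoundary ℓ α p.1.1 then -upperBoundary ℓ α p.1.1 else p.1.2)

lemma tableNormalForm_eq_of_opposite {ℓ α θ : ℝ} (H : Admissible ℓ α θ) {p q : unfoldedTable ℓ α}
    (h : Opposite ℓ α p q) : tableNormalForm ℓ α p = tableNormalForm ℓ α q := by
  rcases h with ⟨h1, h2, h3⟩ | ⟨h1, h2, h3⟩
  · have := upperBoundary_half ℓ α
    simp only [tableNormalForm, h1, h2, h3, this]
    norm_num
  · have hpos := H.upperBoundary_pos p.2.1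
    have hne : -upperBoundary ℓ α p.1.1 ≠ upperBoundary ℓ α p.1.1 := by linarith
    rw [h1] at h2 hne
    simp only [tableNormalForm, h1, h2, h3, if_true, if_neg hne]

/-- `tableNormalForm` on the surface. -/
noncomputable def normalForm {ℓ α θ : ℝ} (H : Admissible ℓ α θ) : Surface ℓ α → ℝ × ℝ :=
  Quot.lift (tableNormalForm ℓ α) fun _ _ h => tableNormalForm_eq_of_opposite H h

lemma neg_mem_unfoldedTable {ℓ α : ℝ} {p : ℝ × ℝ} (h : p ∈ unfoldedTable ℓ α) :
    -p ∈ unfoldedTable ℓ α := by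
  refine ⟨?_, ?_⟩
  · rw [Prod.fst_neg, abs_neg]; exact h.1
  · rw [Prod.snd_neg, abs_neg, Prod.fst_neg, upperBoundary_neg]; exact h.2

section uniqueness

variable {ℓ α θ : ℝ}

/-- A point that can move forward inside the table lies on neither the right side nor, as the
direction is steeper than the boundary, the upper side. It is therefore the canonical
representative. -/
lemma normalForm_of_forward (H : Admissible ℓ α θ) {p : ℝ × ℝ} {ε : ℝ} (hε : 0 < ε)
    (h : ∀ s ∈ Ico 0 ε, p + s • direction θ ∈ unfoldedTable ℓ α) (hp : p ∈ unfoldedTable ℓ α) :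
    normalForm H (Quot.mk _ ⟨p, hp⟩) = p := by
  obtain ⟨h1, h2⟩ := h (ε / 2) ⟨by positivity, by linarith⟩
  have hs : 0 < ε / 2 := half_pos hε
  simp only [direction, Prod.smul_mk, Prod.fst_add, Prod.snd_add, smul_eq_mul] at h1 h2
  have hc := mul_pos hs H.cos_pos
  have h3 := H.upperBoundary_sub_lt hs (x := p.1 + ε / 2 * Real.cos θ) (y := p.1)
    (by rw [add_sub_cancel_left, abs_of_pos hc])
  have hne1 : p.1 ≠ 1 / 2 := by linarith [(abs_le.1 h1).2]
  have hne2 : p.2 ≠ upperBoundary ℓ α p.1 := by linarith [(abs_le.1 h2).2]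
  show tableNormalForm ℓ α ⟨p, hp⟩ = p
  simp only [tableNormalForm, if_neg hne1, if_neg hne2]

lemma eq_of_forward (H : Admissible ℓ α θ) {p₁ p₂ : ℝ × ℝ} {ε₁ ε₂ : ℝ} (hε₁ : 0 < ε₁)
    (hε₂ : 0 < ε₂)
    (h₁ : ∀ s ∈ Ico 0 ε₁, p₁ + s • direction θ ∈ unfoldedTable ℓ α)
    (h₂ : ∀ s ∈ Ico 0 ε₂, p₂ + s • direction θ ∈ unfoldedTable ℓ α)
    (hp₁ : p₁ ∈ unfoldedTable ℓ α) (hp₂ : p₂ ∈ unfoldedTable ℓ α)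
    (h : (Quot.mk _ ⟨p₁, hp₁⟩ : Surface ℓ α) = Quot.mk _ ⟨p₂, hp₂⟩) : p₁ = p₂ := by
  rw [← normalForm_of_forward H hε₁ h₁ hp₁, h, normalForm_of_forward H hε₂ h₂ hp₂]

/-- Trajectories are determined by their starting points. -/
lemma trajectory_unique (H : Admissible ℓ α θ) {T : ℝ} {γ₁ γ₂ : ℝ → Surface ℓ α}
    (h₁ : IsTrajectoryArc ℓ α θ T γ₁)
    (h₂ : IsTrajectoryArc ℓ α θ T γ₂) (h0 : γ₁ 0 = γ₂ 0) : ∀ t ∈ Icc 0 T, γ₁ t = γ₂ t := by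
  by_contra! hcon
  set B := {t | t ∈ Icc 0 T ∧ γ₁ t ≠ γ₂ t} with hB
  have hBne : B.Nonempty := hcon
  have hBbdd : BddBelow B := ⟨0, fun t ht => ht.1.1⟩
  set t₀ := sInf B with ht₀
  have ht₀0 : 0 ≤ t₀ := le_csInf hBne fun t ht => ht.1.1
  have ht₀T : t₀ ≤ T := by
    obtain ⟨t, ht⟩ := hBne
    exact (csInf_le hBbdd ht).trans ht.1.2
  have hlt : ∀ t, 0 ≤ t → t < t₀ → γ₁ t = γ₂ t := fun t ht0 ht => by
    by_contra hne
    exact absurd (csInf_le hBbdd (show t ∈ B from ⟨⟨ht0, ht.le.trans ht₀T⟩, hne⟩)) (not_le.2 ht)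
  have heq : γ₁ t₀ = γ₂ t₀ := by
    rcases ht₀0.eq_or_lt with h | hpos
    · rw [← h, h0]
    obtain ⟨p₁, ε₁, hε₁, H₁⟩ := h₁.backward t₀ ⟨hpos, ht₀T⟩
    obtain ⟨p₂, ε₂, hε₂, H₂⟩ := h₂.backward t₀ ⟨hpos, ht₀T⟩
    obtain ⟨s, hs0, hs⟩ := exists_between (lt_min (lt_min hε₁ hε₂) hpos)
    have hs1 : s < ε₁ := hs.trans_le ((min_le_left _ _).trans (min_le_left _ _))
    have hs2 : s < ε₂ := hs.trans_le ((min_le_left _ _).trans (min_le_right _ _))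
    have hst : s < t₀ := hs.trans_le (min_le_right _ _)
    obtain ⟨g₁, e₁⟩ := H₁ s ⟨hs0.le, hs1⟩
    obtain ⟨g₂, e₂⟩ := H₂ s ⟨hs0.le, hs2⟩
    -- Just before `t₀` the trajectories agree, and both representatives can still move forward, so
    -- they coincide in the table; hence so do the arrival points.
    have hp : p₁ - s • direction θ = p₂ - s • direction θ := by
      refine eq_of_forward H hs0 hs0 (fun s' hs' => ?_) (fun s' hs' => ?_) g₁ g₂ ?_
      · rw [sub_add, ← sub_smul]
        exact (H₁ (s - s') ⟨by linarith [hs'.2], by linarith [hs'.1]⟩).1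
      · rw [sub_add, ← sub_smul]
        exact (H₂ (s - s') ⟨by linarith [hs'.2], by linarith [hs'.1]⟩).1
      · rw [← e₁, ← e₂]
        exact hlt _ (by linarith) (by linarith)
    obtain rfl : p₁ = p₂ := sub_left_injective hp
    obtain ⟨_, f₁⟩ := H₁ 0 ⟨le_rfl, hε₁⟩
    obtain ⟨_, f₂⟩ := H₂ 0 ⟨le_rfl, hε₂⟩
    rw [sub_zero] at f₁ f₂
    rw [f₁, f₂]
  rcases ht₀T.eq_or_lt with h | hltT
  · obtain ⟨t, ht⟩ := hBne
    have h3 : t = t₀ := le_antisymm (ht.1.2.trans h.ge) (csInf_le hBbdd ht)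
    exact ht.2 (h3 ▸ heq)
  obtain ⟨p₁, ε₁, hε₁, H₁⟩ := h₁.forward t₀ ⟨ht₀0, hltT⟩
  obtain ⟨p₂, ε₂, hε₂, H₂⟩ := h₂.forward t₀ ⟨ht₀0, hltT⟩
  have hp : p₁ = p₂ := by
    obtain ⟨g₁, e₁⟩ := H₁ 0 ⟨le_rfl, hε₁⟩
    obtain ⟨g₂, e₂⟩ := H₂ 0 ⟨le_rfl, hε₂⟩
    rw [add_zero] at e₁ e₂
    have := eq_of_forward H hε₁ hε₂ (p₁ := p₁ + (0 : ℝ) • direction θ)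
      (p₂ := p₂ + (0 : ℝ) • direction θ)
      (fun s hs => by rw [zero_smul, add_zero]; exact (H₁ s hs).1)
      (fun s hs => by rw [zero_smul, add_zero]; exact (H₂ s hs).1) g₁ g₂
      (by rw [← e₁, ← e₂, heq])
    simpa using this
  subst hp
  obtain ⟨t, ht, htlt⟩ := exists_lt_of_csInf_lt hBne
    (show t₀ < t₀ + min ε₁ ε₂ by linarith [lt_min hε₁ hε₂])
  have hle : t₀ ≤ t := csInf_le hBbdd ht
  obtain ⟨_, f₁⟩ := H₁ (t - t₀) ⟨by linarith, by linarith [min_le_left ε₁ ε₂]⟩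
  obtain ⟨_, f₂⟩ := H₂ (t - t₀) ⟨by linarith, by linarith [min_le_right ε₁ ε₂]⟩
  rw [add_sub_cancel] at f₁ f₂
  exact ht.2 (by rw [f₁, f₂])

lemma IsTrajectoryArc.mono {T T' : ℝ} (hT : T' ≤ T) {γ : ℝ → Surface ℓ α}
    (h : IsTrajectoryArc ℓ α θ T γ) : IsTrajectoryArc ℓ α θ T' γ :=
  ⟨fun t ht => h.forward t ⟨ht.1, ht.2.trans_le hT⟩,
    fun t ht => h.backward t ⟨ht.1, ht.2.trans hT⟩⟩

end uniqueness

/-! ### The first-return map -/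

/-- The periodic extension of `upperBoundary`. -/
noncomputable def height (ℓ α x : ℝ) : ℝ := ℓ + Real.tan α / 4 + wave (Real.tan α) x

lemma upperBoundary_sub_int {ℓ α x : ℝ} {n : ℤ} (h : |x - n| ≤ 1 / 2) :
    upperBoundary ℓ α (x - n) = height ℓ α x := by
  rw [height, wave_eq_of_abs_le h, upperBoundary]; ring

lemma height_neg (ℓ α x : ℝ) : height ℓ α (-x) = height ℓ α x := by
  rw [height, wave_neg, height]

/-- The point of the surface represented by a point of the table. -/
def surfacePoint {ℓ α : ℝ} (p : unfoldedTable ℓ α) : Surface ℓ α := Quot.mk _ p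

open Classical in
/-- The point of the surface with coordinates `(x, y)`, where `x` is taken modulo `1`. -/
noncomputable def toSurface {ℓ α : ℝ} (P₀ : Surface ℓ α) (x y : ℝ) : Surface ℓ α :=
  if h : (x - round x, y) ∈ unfoldedTable ℓ α then surfacePoint ⟨_, h⟩ else P₀

lemma sub_round_lt_half (x : ℝ) : x - round x < 1 / 2 := by
  have := Int.lt_floor_add_one (x + 1 / 2)
  rw [round_eq]; linarith

/-- Besides `round x`, only `round x - 1` can occur as `n`, with `x` at a half-integer; the two
representatives are then opposite points of the vertical sides. -/
lemma toSurface_eq {ℓ α : ℝ} (P₀ : Surface ℓ α) {x y : ℝ} {P : ℝ × ℝ} (n : ℤ)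
    (h1 : P.1 = x - n) (h2 : P.2 = y) (hP : P ∈ unfoldedTable ℓ α) :
    toSurface P₀ x y = Quot.mk _ ⟨P, hP⟩ := by
  obtain ⟨a, b⟩ := P
  obtain rfl : a = x - n := h1
  obtain rfl : b = y := h2
  have hx : |x - n| ≤ 1 / 2 := hP.1
  have hmem : (x - round x, b) ∈ unfoldedTable ℓ α := by
    refine ⟨abs_sub_round x, ?_⟩
    have := hP.2
    simp only at this ⊢
    rw [upperBoundary_sub_int hx] at this
    rwa [upperBoundary_sub_int (abs_sub_round x)]
  refine (dif_pos hmem).trans ?_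
  rcases eq_or_ne n (round x) with rfl | hne
  · rfl
  have h3 := sub_round_lt_half x
  have h4 := (abs_le.1 (abs_sub_round x)).1
  obtain ⟨h5, h6⟩ := abs_le.1 hx
  have h7 : (n : ℝ) + 1 = round x := by
    have a1 : (n : ℝ) + 2 > round x := by linarith
    have a2 : (n : ℝ) < round x + 1 := by linarith
    have a3 : round x < n + 2 := by exact_mod_cast a1
    have a4 : n < round x + 1 := by exact_mod_cast a2
    have : n + 1 = round x := by omega
    exact_mod_cast this
  refine Quot.sound (Or.inl ⟨?_, ?_, rfl⟩)
  · show x - round x = _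
    linarith
  · show x - n = _
    linarith

lemma isSectionPoint_toSurface {ℓ α : ℝ} (hℓ : 0 ≤ ℓ) (hα : 0 ≤ Real.tan α) (P₀ : Surface ℓ α)
    (x : ℝ) : IsSectionPoint ℓ α (x : UnitAddCircle) (toSurface P₀ x 0) := by
  have h : (x - round x, (0 : ℝ)) ∈ unfoldedTable ℓ α := by
    refine ⟨abs_sub_round x, ?_⟩
    have := mul_nonneg hα (sub_nonneg.2 (abs_sub_round x))
    simp only [abs_zero, upperBoundary]
    linarith
  refine ⟨x - round x, ?_, h, toSurface_eq P₀ (round x) rfl rfl h⟩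
  rw [AddCircle.coe_sub, sub_eq_self, AddCircle.coe_eq_zero_iff]
  exact ⟨round x, by simp⟩

lemma eq_toSurface_of_isSectionPoint {ℓ α : ℝ} (P₀ : Surface ℓ α) {x : ℝ} {P : Surface ℓ α}
    (h : IsSectionPoint ℓ α (x : UnitAddCircle) P) : P = toSurface P₀ x 0 := by
  obtain ⟨a, ha, hmem, rfl⟩ := h
  rw [← sub_eq_zero, ← AddCircle.coe_sub, AddCircle.coe_eq_zero_iff] at ha
  obtain ⟨n, hn⟩ := ha
  refine (toSurface_eq P₀ (-n) ?_ rfl hmem).symm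
  simp only [zsmul_eq_mul, mul_one] at hn
  push_cast
  linarith

section existence

variable {ℓ α θ : ℝ}

lemma sectionPoint_unique (H : Admissible ℓ α θ) {P : Surface ℓ α} {z z' : UnitAddCircle}
    (h : IsSectionPoint ℓ α z P) (h' : IsSectionPoint ℓ α z' P) : z = z' := by
  have key : ∀ w, IsSectionPoint ℓ α w P → ((normalForm H P).1 : UnitAddCircle) = w := by
    rintro _ ⟨a, rfl, hmem, rfl⟩
    show ((tableNormalForm ℓ α ⟨(a, 0), hmem⟩).1 : UnitAddCircle) = a
    simp only [tableNormalForm]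
    split_ifs with ha
    · rw [ha, ← AddCircle.coe_add_period (1 : ℝ) (-(1 / 2))]
      norm_num
    · rfl
  rw [← key z h, ← key z' h']

lemma normalForm_snd_of_isSectionPoint (H : Admissible ℓ α θ) {P : Surface ℓ α} {z : UnitAddCircle}
    (h : IsSectionPoint ℓ α z P) : (normalForm H P).2 = 0 := by
  obtain ⟨a, rfl, hmem, rfl⟩ := h
  show (tableNormalForm ℓ α ⟨(a, 0), hmem⟩).2 = 0
  exact if_neg (H.upperBoundary_pos hmem.1).ne

lemma not_isSectionPoint_toSurface (H : Admissible ℓ α θ) (P₀ : Surface ℓ α) {x y : ℝ} (hy : y ≠ 0)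
    (h : |y| ≤ height ℓ α x) (z : UnitAddCircle) : ¬ IsSectionPoint ℓ α z (toSurface P₀ x y) := by
  intro hz
  have hx := abs_sub_round x
  have hmem : (x - round x, y) ∈ unfoldedTable ℓ α :=
    ⟨hx, by simpa only [upperBoundary_sub_int hx] using h⟩
  rw [toSurface_eq P₀ (round x) rfl rfl hmem] at hz
  have h0 := normalForm_snd_of_isSectionPoint H hz
  change (if y = upperBoundary ℓ α (x - round x) then -upperBoundary ℓ α (x - round x) else y) = 0
    at h0
  have := H.upperBoundary_pos hx
  split_ifs at h0 with h1
  · linarith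
  · exact hy h0

lemma toSurface_lower_eq_upper (H : Admissible ℓ α θ) (P₀ : Surface ℓ α) (x : ℝ) :
    toSurface P₀ x (-height ℓ α x) = toSurface P₀ x (height ℓ α x) := by
  have hx := abs_sub_round x
  have hb : upperBoundary ℓ α (x - round x) = height ℓ α x := upperBoundary_sub_int hx
  have hpos := H.upperBoundary_pos hx
  rw [hb] at hpos
  have h1 : (x - round x, -height ℓ α x) ∈ unfoldedTable ℓ α :=
    ⟨hx, by simp only [hb, abs_neg, abs_of_pos hpos, le_refl]⟩
  have h2 : (x - round x, height ℓ α x) ∈ unfoldedTable ℓ α :=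
    ⟨hx, by simp only [hb, abs_of_pos hpos, le_refl]⟩
  rw [toSurface_eq P₀ (round x) rfl rfl h1, toSurface_eq P₀ (round x) rfl rfl h2]
  exact Quot.sound (Or.inr ⟨rfl, by simp only [hb], by simp only [hb]⟩)

lemma exists_forward (H : Admissible ℓ α θ) {x y : ℝ} (h1 : -height ℓ α x ≤ y)
    (h2 : y < height ℓ α x) :
    ∃ n : ℤ, ∃ ε > (0 : ℝ), ∀ s ∈ Ico 0 ε, (x - n, y) + s • direction θ ∈ unfoldedTable ℓ α := by
  have hx := abs_sub_round x
  rw [← upperBoundary_sub_int hx] at h1 h2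
  have hc := H.cos_pos
  have hs := H.sin_pos
  refine ⟨round x, min ((1 / 2 - (x - round x)) / Real.cos θ)
    ((upperBoundary ℓ α (x - round x) - y) / (2 * Real.sin θ)),
    lt_min (div_pos (by linarith [sub_round_lt_half x]) hc)
      (div_pos (by linarith) (by positivity)), fun s hs' => ?_⟩
  have h3 := (lt_div_iff₀ hc).1 (hs'.2.trans_le (min_le_left _ _))
  have h4 := (lt_div_iff₀ (by positivity)).1 (hs'.2.trans_le (min_le_right _ _))
  have h5 := mul_nonneg hs'.1 hc.le
  have h6 := H.upperBoundary_sub_le' (x := x - round x) (y := x - round x + s * Real.cos θ) hs'.1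
    (by rw [sub_add_cancel_left, abs_neg, abs_of_nonneg h5])
  rw [abs_le] at hx
  refine ⟨abs_le.2 ⟨?_, ?_⟩, abs_le.2 ⟨?_, ?_⟩⟩ <;>
    simp only [direction, Prod.smul_mk, Prod.mk_add_mk, smul_eq_mul] <;> linarith

lemma exists_backward (H : Admissible ℓ α θ) {x y : ℝ} (h1 : -height ℓ α x < y)
    (h2 : y ≤ height ℓ α x) :
    ∃ n : ℤ, ∃ ε > (0 : ℝ), ∀ s ∈ Ico 0 ε, (x - n, y) - s • direction θ ∈ unfoldedTable ℓ α := by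
  obtain ⟨n, ε, hε, h⟩ := exists_forward H (x := -x) (y := -y) (by rw [height_neg]; linarith)
    (by rw [height_neg]; linarith)
  refine ⟨-n, ε, hε, fun s hs => ?_⟩
  convert neg_mem_unfoldedTable (h s hs) using 1
  ext
  · simp; ring
  · simp; ring

lemma height_sub_lt (H : Admissible ℓ α θ) {x y s : ℝ} (hs : 0 < s)
    (h : |x - y| = s * Real.cos θ) : height ℓ α x - height ℓ α y < s * Real.sin θ := by
  have h1 := (abs_le.1 (abs_wave_sub_le H.tan_pos.le x y)).2
  have h2 := mul_lt_mul_of_pos_left H.tan_mul_cos_lt hs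
  rw [h] at h1
  unfold height
  linarith

/-- The arc of trajectory between two consecutive visits of the section. -/
lemma exists_trajectoryArc (H : Admissible ℓ α θ) (P₀ : Surface ℓ α) {a x u : ℝ} (hu : 0 < u)
    (hx : x = a + u * Real.cos θ) (hh : height ℓ α x = u * Real.sin θ) :
    ∃ γ, IsTrajectoryArc ℓ α θ (2 * u) γ ∧ γ 0 = toSurface P₀ a 0 ∧
      γ (2 * u) = toSurface P₀ (a + 2 * u * Real.cos θ) 0 ∧
      ∀ t ∈ Ioo 0 (2 * u), ∀ z, ¬ IsSectionPoint ℓ α z (γ t) := by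
  set f : ℝ → Surface ℓ α := fun t => toSurface P₀ (a + t * Real.cos θ) (t * Real.sin θ) with hf
  set g : ℝ → Surface ℓ α := fun t =>
    toSurface P₀ (a + t * Real.cos θ) (t * Real.sin θ - 2 * height ℓ α x) with hg
  set γ : ℝ → Surface ℓ α := fun t => if t ≤ u then f t else g t with hγ
  have hsin := H.sin_pos
  have hcos := H.cos_pos
  have hγf : ∀ t ≤ u, γ t = f t := fun t ht => if_pos ht
  have hγg : ∀ t, u ≤ t → γ t = g t := fun t ht => by
    -- At the gluing time `u` the two formulas give opposite points of the upper and lower sides.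
    rcases ht.eq_or_lt with rfl | ht
    · rw [hγf _ le_rfl, hf, hg]
      simp only
      rw [← hx, ← hh, ← toSurface_lower_eq_upper H]
      congr 1; ring
    · exact if_neg (not_le.2 ht)
  have habs {t t' : ℝ} (h : t ≤ t') : |a + t' * Real.cos θ - (a + t * Real.cos θ)| =
      (t' - t) * Real.cos θ := by
    rw [show a + t' * Real.cos θ - (a + t * Real.cos θ) = (t' - t) * Real.cos θ by ring,
      abs_of_nonneg (mul_nonneg (sub_nonneg.2 h) hcos.le)]
  have hf1 : ∀ t < u, t * Real.sin θ < height ℓ α (a + t * Real.cos θ) := fun t ht => by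
    have := height_sub_lt (ℓ := ℓ) H (sub_pos.2 ht) (habs ht.le)
    rw [← hx, hh] at this
    linarith
  have hg1 : ∀ t, u < t → -height ℓ α (a + t * Real.cos θ) <
      t * Real.sin θ - 2 * height ℓ α x := fun t ht => by
    have := height_sub_lt (ℓ := ℓ) H (sub_pos.2 ht) (by rw [abs_sub_comm]; exact habs ht.le)
    rw [← hx, hh] at this
    linarith
  have hpos : ∀ y, 0 < height ℓ α y := fun y => by
    rw [← upperBoundary_sub_int (abs_sub_round y)]
    exact H.upperBoundary_pos (abs_sub_round y)
  have hfu : ∀ t ≤ u, t * Real.sin θ ≤ height ℓ α (a + t * Real.cos θ) := fun t ht => by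
    rcases ht.eq_or_lt with rfl | ht
    · rw [← hx, hh]
    · exact (hf1 t ht).le
  have hgu : ∀ t, u ≤ t → -height ℓ α (a + t * Real.cos θ) ≤
      t * Real.sin θ - 2 * height ℓ α x := fun t ht => by
    rcases ht.eq_or_lt with rfl | ht
    · rw [← hx, hh]; linarith
    · exact (hg1 t ht).le
  refine ⟨γ, ⟨fun t ht => ?_, fun t ht => ?_⟩, ?_, ?_, fun t ht z => ?_⟩
  · rcases lt_or_ge t u with htu | htu
    · obtain ⟨n, ε, hε, h⟩ := exists_forward H (x := a + t * Real.cos θ) (y := t * Real.sin θ)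
        (by linarith [hpos (a + t * Real.cos θ), mul_nonneg ht.1 hsin.le]) (hf1 t htu)
      refine ⟨_, min ε (u - t), lt_min hε (sub_pos.2 htu), fun s hs =>
        ⟨h s ⟨hs.1, hs.2.trans_le (min_le_left _ _)⟩, ?_⟩⟩
      rw [hγf _ (by linarith [hs.2, min_le_right ε (u - t)])]
      exact toSurface_eq P₀ n (by simp [direction]; ring) (by simp [direction]; ring) _
    · have h2 : t * Real.sin θ < 2 * height ℓ α x := by
        rw [hh, ← mul_assoc]
        exact mul_lt_mul_of_pos_right ht.2 hsin
      obtain ⟨n, ε, hε, h⟩ := exists_forward H (x := a + t * Real.cos θ)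
        (y := t * Real.sin θ - 2 * height ℓ α x) (hgu t htu)
        (by linarith [hpos (a + t * Real.cos θ)])
      refine ⟨_, ε, hε, fun s hs => ⟨h s hs, ?_⟩⟩
      rw [hγg _ (by linarith [hs.1])]
      exact toSurface_eq P₀ n (by simp [direction]; ring) (by simp [direction]; ring) _
  · rcases le_or_gt t u with htu | htu
    · obtain ⟨n, ε, hε, h⟩ := exists_backward H (x := a + t * Real.cos θ) (y := t * Real.sin θ)
        (by linarith [hpos (a + t * Real.cos θ), mul_nonneg ht.1.le hsin.le]) (hfu t htu)
      refine ⟨_, ε, hε, fun s hs => ⟨h s hs, ?_⟩⟩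
      rw [hγf _ (by linarith [hs.1])]
      exact toSurface_eq P₀ n (by simp [direction]; ring) (by simp [direction]; ring) _
    · have h2 : t * Real.sin θ ≤ 2 * height ℓ α x := by
        rw [hh, ← mul_assoc]
        exact mul_le_mul_of_nonneg_right ht.2 hsin.le
      obtain ⟨n, ε, hε, h⟩ := exists_backward H (x := a + t * Real.cos θ)
        (y := t * Real.sin θ - 2 * height ℓ α x) (hg1 t htu)
        (by linarith [hpos (a + t * Real.cos θ)])
      refine ⟨_, min ε (t - u), lt_min hε (sub_pos.2 htu), fun s hs =>
        ⟨h s ⟨hs.1, hs.2.trans_le (min_le_left _ _)⟩, ?_⟩⟩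
      rw [hγg _ (by linarith [hs.2, min_le_right ε (t - u)])]
      exact toSurface_eq P₀ n (by simp [direction]; ring) (by simp [direction]; ring) _
  · rw [hγf 0 hu.le, hf]
    simp
  · rw [hγg _ (by linarith), hg]
    simp only
    congr 1
    rw [hh]; ring
  · rcases le_or_gt t u with htu | htu
    · rw [hγf t htu]
      have := mul_pos ht.1 hsin
      exact not_isSectionPoint_toSurface H P₀ this.ne' (by rw [abs_of_pos this]; exact hfu t htu) z
    · rw [hγg t htu.le]
      have h2 : t * Real.sin θ < 2 * height ℓ α x := by
        rw [hh, ← mul_assoc]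
        exact mul_lt_mul_of_pos_right ht.2 hsin
      exact not_isSectionPoint_toSurface H P₀ (by linarith)
        (abs_le.2 ⟨hgu t htu.le, by linarith [hpos (a + t * Real.cos θ)]⟩) z

lemma isFirstReturn_unique (H : Admissible ℓ α θ) {x x₁ x₂ : UnitAddCircle}
    (h₁ : IsFirstReturn ℓ α θ x x₁) (h₂ : IsFirstReturn ℓ α θ x x₂) : x₁ = x₂ := by
  wlog hle : ∃ T₁ T₂ : ℝ, ∃ γ₁ γ₂ : ℝ → Surface ℓ α, T₁ ≤ T₂ ∧
      (0 < T₁ ∧ IsTrajectoryArc ℓ α θ T₁ γ₁ ∧ IsSectionPoint ℓ α x (γ₁ 0) ∧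
        IsSectionPoint ℓ α x₁ (γ₁ T₁) ∧ ∀ t ∈ Ioo 0 T₁, ∀ z, ¬ IsSectionPoint ℓ α z (γ₁ t)) ∧
      (0 < T₂ ∧ IsTrajectoryArc ℓ α θ T₂ γ₂ ∧ IsSectionPoint ℓ α x (γ₂ 0) ∧
        IsSectionPoint ℓ α x₂ (γ₂ T₂) ∧ ∀ t ∈ Ioo 0 T₂, ∀ z, ¬ IsSectionPoint ℓ α z (γ₂ t))
    generalizing x₁ x₂
  · obtain ⟨T₁, γ₁, H₁⟩ := id h₁
    obtain ⟨T₂, γ₂, H₂⟩ := id h₂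
    rcases le_total T₁ T₂ with h | h
    · exact absurd ⟨T₁, T₂, γ₁, γ₂, h, H₁, H₂⟩ hle
    · exact (this h₂ h₁ ⟨T₂, T₁, γ₂, γ₁, h, H₂, H₁⟩).symm
  obtain ⟨T₁, T₂, γ₁, γ₂, hT, ⟨p₁, a₁, s₁, e₁, n₁⟩, ⟨p₂, a₂, s₂, e₂, n₂⟩⟩ := hle
  obtain ⟨a, rfl⟩ := QuotientAddGroup.mk_surjective x
  have h0 : γ₁ 0 = γ₂ 0 := by
    rw [eq_toSurface_of_isSectionPoint (γ₁ 0) s₁]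
    exact (eq_toSurface_of_isSectionPoint (γ₁ 0) s₂).symm
  -- At the earlier return time the other trajectory is on the section too, so it cannot return
  -- later.
  have heq := trajectory_unique H a₁ (a₂.mono hT) h0 T₁ ⟨p₁.le, le_rfl⟩
  rw [heq] at e₁
  rcases hT.eq_or_lt with rfl | hlt
  · exact sectionPoint_unique H e₁ e₂
  · exact absurd e₁ (n₂ T₁ ⟨p₁, hlt⟩ x₁)

/-- The ratio of the slopes of the boundary and of the trajectories. -/
noncomputable def Admissible.ratio (H : Admissible ℓ α θ) : Ioo (0 : ℝ) 1 :=
  ⟨Real.tan α * Real.cos θ / Real.sin θ, div_pos (mul_pos H.tan_pos H.cos_pos) H.sin_pos,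
    (div_lt_one H.sin_pos).2 H.tan_mul_cos_lt⟩

/-- The mean horizontal displacement between the section and the upper boundary. -/
noncomputable def Admissible.shift (H : Admissible ℓ α θ) : ℝ :=
  ℓ * (Real.cos θ / Real.sin θ) + H.ratio / 4

lemma height_mul (H : Admissible ℓ α θ) (x : ℝ) :
    height ℓ α x * Real.cos θ = Real.sin θ * (H.shift + wave H.ratio x) := by
  have := H.sin_pos.ne'
  simp only [Admissible.shift, Admissible.ratio, height, wave]
  field_simp

/-- A lift of the return map. -/
noncomputable def returnLift (k : Ioo (0 : ℝ) 1) (s : ℝ) : CircleDeg1Lift where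
  toFun x := centredMap k (x + s) + s
  monotone' _ _ h := add_le_add_left ((strictMono_centredMap k).monotone (add_le_add_left h s)) s
  map_add_one' x := by
    rw [add_right_comm, centredMap_add_one, add_right_comm]

lemma returnLift_apply (k : Ioo (0 : ℝ) 1) (s x : ℝ) :
    returnLift k s x = centredMap k (x + s) + s := rfl

lemma isFirstReturn_returnLift (H : Admissible ℓ α θ) (a : ℝ) :
    IsFirstReturn ℓ α θ (a : UnitAddCircle) (returnLift H.ratio H.shift a : ℝ) := by
  have hsin := H.sin_pos
  have hcos := H.cos_pos
  have hsc := height_mul H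
  set k := H.ratio
  set s := H.shift
  set x := foot k (a + s) with hx
  set u := height ℓ α x / Real.sin θ with hu
  have hpos : 0 < height ℓ α x := by
    rw [← upperBoundary_sub_int (abs_sub_round x)]
    exact H.upperBoundary_pos (abs_sub_round x)
  -- The horizontal displacement up to the hitting point is `s + wave k x`, so `lowerMap k x = a +
  -- s` is exactly the hitting condition.
  have hu1 : u * Real.cos θ = s + wave k x := by
    rw [hu, div_mul_eq_mul_div, hsc, mul_div_cancel_left₀ _ hsin.ne']
  have hlow := lowerMap_foot k (a + s)
  rw [← hx, lowerMap] at hlow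
  have hmem : ((0 : ℝ), (0 : ℝ)) ∈ unfoldedTable ℓ α :=
    ⟨by norm_num, by simpa using (H.upperBoundary_pos (x := 0) (by norm_num)).le⟩
  obtain ⟨γ, h1, h2, h3, h4⟩ := exists_trajectoryArc H (surfacePoint ⟨_, hmem⟩) (a := a) (x := x)
    (div_pos hpos hsin) (by linarith) (div_mul_cancel₀ _ hsin.ne').symm
  refine ⟨2 * u, γ, by positivity, h1, ?_, ?_, h4⟩
  · rw [h2]
    exact isSectionPoint_toSurface H.base_pos.le H.tan_pos.le _ _
  · have : returnLift k s a = a + 2 * u * Real.cos θ := by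
      rw [returnLift_apply, centredMap, ← hx, upperMap]
      linarith
    rw [h3, this]
    exact isSectionPoint_toSurface H.base_pos.le H.tan_pos.le _ _

lemma returnMap_coe (H : Admissible ℓ α θ) (a : ℝ) :
    returnMap ℓ α θ (a : UnitAddCircle) = (returnLift H.ratio H.shift a : ℝ) :=
  isFirstReturn_unique H (Classical.epsilon_spec ⟨_, isFirstReturn_returnLift H a⟩)
    (isFirstReturn_returnLift H a)

lemma isFirstReturn_iff (H : Admissible ℓ α θ) (x x' : UnitAddCircle) :
    IsFirstReturn ℓ α θ x x' ↔ x' = returnMap ℓ α θ x := by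
  obtain ⟨a, rfl⟩ := QuotientAddGroup.mk_surjective x
  have h := isFirstReturn_returnLift H a
  rw [← returnMap_coe H a] at h
  exact ⟨fun h' => isFirstReturn_unique H h' h, fun h' => h' ▸ h⟩

end existence

lemma strictMono_returnLift (k : Ioo (0 : ℝ) 1) (s : ℝ) : StrictMono (returnLift k s) :=
  fun _ _ h => add_lt_add_left (strictMono_centredMap k (add_lt_add_left h s)) s

lemma continuous_returnLift (k : Ioo (0 : ℝ) 1) (s : ℝ) : Continuous (returnLift k s) :=
  ((continuous_centredMap k).comp (continuous_id.add continuous_const)).add continuous_const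

/-- A circle map with a lift is a homeomorphism. -/
lemma IsLift.isHomeomorph {f : UnitAddCircle → UnitAddCircle} {F : CircleDeg1Lift}
    (h : IsLift f F) : IsHomeomorph f := by
  rw [isHomeomorph_iff_continuous_bijective]
  refine ⟨?_, fun x y hxy => ?_, fun y => ?_⟩
  · refine QuotientAddGroup.isOpenQuotientMap_mk.isQuotientMap.continuous_iff.2 ?_
    exact ((AddCircle.continuous_mk' (1 : ℝ)).comp h.continuous).congr h.semiconj
  · obtain ⟨a, rfl⟩ := QuotientAddGroup.mk_surjective x
    obtain ⟨b, rfl⟩ := QuotientAddGroup.mk_surjective y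
    have h1 : ((F a : ℝ) : UnitAddCircle) = (F b : ℝ) := by
      rw [h.semiconj, h.semiconj]; exact hxy
    rw [← sub_eq_zero, ← AddCircle.coe_sub, AddCircle.coe_eq_zero_iff] at h1
    obtain ⟨n, hn⟩ := h1
    simp only [zsmul_eq_mul, mul_one] at hn
    have h2 : a = b + n := h.strictMono.injective (by rw [F.map_add_int]; linarith)
    show ((a : ℝ) : UnitAddCircle) = b
    rw [← sub_eq_zero, ← AddCircle.coe_sub, AddCircle.coe_eq_zero_iff]
    exact ⟨n, by simp [h2]⟩
  · obtain ⟨b, rfl⟩ := QuotientAddGroup.mk_surjective y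
    obtain ⟨a, rfl⟩ := F.continuous_iff_surjective.1 h.continuous b
    exact ⟨a, (h.semiconj a).symm⟩

lemma isLift_returnLift {ℓ α θ : ℝ} (H : Admissible ℓ α θ) :
    IsLift (returnMap ℓ α θ) (returnLift H.ratio H.shift) :=
  ⟨continuous_returnLift _ _, strictMono_returnLift _ _, fun x => (returnMap_coe H x).symm⟩

/-! ### Almost every trapezoid and direction -/

lemma translationNumber_returnLift (k : Ioo (0 : ℝ) 1) (s : ℝ) :
    (returnLift k s).translationNumber = rotation k (2 * s) := by
  refine CircleDeg1Lift.translationNumber_eq_of_semiconj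
    (f := (CircleDeg1Lift.translate (Multiplicative.ofAdd s) : CircleDeg1Lift)) fun x => ?_
  rw [CircleDeg1Lift.translate_apply, CircleDeg1Lift.translate_apply, returnLift_apply,
    rotatedMap_apply, add_comm x s]
  ring

open Classical in
/-- A retraction of the line onto the unit interval. -/
noncomputable def toRatio (x : ℝ) : Ioo (0 : ℝ) 1 :=
  if h : x ∈ Ioo (0 : ℝ) 1 then ⟨x, h⟩ else ⟨1 / 2, by norm_num⟩

lemma toRatio_coe (k : Ioo (0 : ℝ) 1) : toRatio k = k := dif_pos k.2

lemma measurable_toRatio : Measurable fun x => (toRatio x : ℝ) := by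
  classical
  have : (fun x => (toRatio x : ℝ)) = fun x => if x ∈ Ioo (0 : ℝ) 1 then x else 1 / 2 := by
    ext x
    unfold toRatio
    split_ifs <;> rfl
  rw [this]
  exact Measurable.ite measurableSet_Ioo measurable_id measurable_const

lemma measurable_wave_comp {X : Type*} [MeasurableSpace X] {f g : X → ℝ} (hf : Measurable f)
    (hg : Measurable g) : Measurable fun p => wave (f p) (g p) := by
  have h (k x : ℝ) : wave k x = k * wave 1 x := by simp only [wave]; ring
  simp only [h (f _)]
  exact hf.mul ((continuous_wave zero_le_one).measurable.comp hg)

/-- Sublevel sets of `foot` are described by `lowerMap`, which is explicit in `k`, so no regularity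
of the inverse in `k` is needed. -/
lemma measurable_centredMap_comp {X : Type*} [MeasurableSpace X] {f g : X → ℝ} (hf : Measurable f)
    (hg : Measurable g) : Measurable fun p => centredMap (toRatio (f p)) (g p) := by
  have hr := measurable_toRatio.comp hf
  have hfoot : Measurable fun p => foot (toRatio (f p)) (g p) := by
    refine measurable_of_Iio fun c => ?_
    have : (fun p => foot (toRatio (f p)) (g p)) ⁻¹' Iio c =
        {p | g p < lowerMap (toRatio (f p)) c} := by
      ext p
      exact foot_lt_iff _ _ _
    rw [this]
    exact measurableSet_lt hg (measurable_const.sub (measurable_wave_comp hr measurable_const))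
  exact hfoot.add (measurable_wave_comp hr hfoot)

lemma measurable_iterate (n : ℕ) :
    Measurable fun p : ℝ × ℝ => (rotatedMap (toRatio p.1) p.2)^[n] 0 := by
  induction n with
  | zero => exact measurable_const
  | succ n ih =>
    simp only [Function.iterate_succ_apply', rotatedMap_apply]
    exact (measurable_centredMap_comp measurable_fst ih).add measurable_snd

lemma tendsto_iterate_div (k : Ioo (0 : ℝ) 1) (t : ℝ) :
    Tendsto (fun n : ℕ => (rotatedMap k t)^[n] 0 / n) atTop (𝓝 (rotation k t)) :=
  (rotatedMap k t).tendsto_translation_number₀.congr fun n => by rw [CircleDeg1Lift.coe_pow]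

lemma measurable_rotation : Measurable fun p : ℝ × ℝ => rotation (toRatio p.1) p.2 :=
  measurable_of_tendsto_metrizable
    (f := fun (n : ℕ) (p : ℝ × ℝ) => (rotatedMap (toRatio p.1) p.2)^[n] 0 / n)
    (fun n => (measurable_iterate n).div_const _)
    (tendsto_pi_nhds.2 fun p => tendsto_iterate_div (toRatio p.1) p.2)

lemma measurableSet_irrational : MeasurableSet {x : ℝ | Irrational x} :=
  (countable_range ((↑) : ℚ → ℝ)).measurableSet.compl

/-- The exceptional pairs of a ratio of slopes and the cotangent of a direction. -/
def exceptionalSet (ℓ : ℝ) : Set (ℝ × ℝ) :=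
  {p | Irrational (rotation (toRatio p.1) (2 * (ℓ * p.2 + toRatio p.1 / 4)))}

lemma measurableSet_exceptionalSet (ℓ : ℝ) : MeasurableSet (exceptionalSet ℓ) := by
  have h : Measurable fun p : ℝ × ℝ => (p.1, 2 * (ℓ * p.2 + (toRatio p.1 : ℝ) / 4)) :=
    measurable_fst.prodMk (((measurable_snd.const_mul ℓ).add
      ((measurable_toRatio.comp measurable_fst).div_const 4)).const_mul 2)
  exact (measurable_rotation.comp h) measurableSet_irrational

/-- For a fixed ratio, `t` depends on the cotangent affinely with slope `2 ℓ ≠ 0`, so each slice is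
null; Fubini concludes. -/
lemma volume_exceptionalSet {ℓ : ℝ} (hℓ : 0 < ℓ) : volume (exceptionalSet ℓ) = 0 := by
  rw [Measure.volume_eq_prod, Measure.measure_prod_null (measurableSet_exceptionalSet ℓ)]
  refine Eventually.of_forall fun x => ?_
  have h := addHaar_image_eq_zero_of_differentiableOn_of_addHaar_eq_zero volume
    (f := fun t : ℝ => (t / 2 - toRatio x / 4) / ℓ) (by fun_prop)
    (volume_irrational_rotation (toRatio x))
  refine measure_mono_null ?_ h
  intro u hu
  refine ⟨2 * (ℓ * u + toRatio x / 4), hu, ?_⟩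
  field_simp
  ring

lemma irrational_mem_image {ℓ α θ : ℝ} (H : Admissible ℓ α θ)
    (h : Irrational (returnLift H.ratio H.shift).translationNumber) :
    (α, θ) ∈ (fun p : ℝ × ℝ => (Real.arctan (p.1 / p.2), Real.arctan (1 / p.2))) ''
      (exceptionalSet ℓ ∩ {p | p.2 ≠ 0}) := by
  have hs := H.sin_pos.ne'
  have hc := H.cos_pos.ne'
  refine ⟨((H.ratio : ℝ), Real.cos θ / Real.sin θ), ⟨?_, div_ne_zero hc hs⟩, ?_⟩
  · rw [translationNumber_returnLift] at h
    change Irrational (rotation (toRatio H.ratio) (2 * (_ + toRatio H.ratio / 4)))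
    rw [toRatio_coe]
    exact h
  · have h1 : (H.ratio : ℝ) / (Real.cos θ / Real.sin θ) = Real.tan α := by
      simp only [Admissible.ratio]
      field_simp
    have h2 : 1 / (Real.cos θ / Real.sin θ) = Real.tan θ := by
      rw [one_div_div, Real.tan_eq_sin_div_cos]
    have hα := H.angle_pos
    have hθ := H.lt_pi_div_two
    have hαθ := H.angle_lt
    simp only [h1, h2]
    rw [Real.arctan_tan (by linarith) (by linarith), Real.arctan_tan (by linarith) hθ]

/-- Differentiable maps between spaces of equal dimension send null sets to null sets; the map
recovers the angles from the ratio and the cotangent. -/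
lemma volume_image_exceptionalSet {ℓ : ℝ} (hℓ : 0 < ℓ) :
    volume ((fun p : ℝ × ℝ => (Real.arctan (p.1 / p.2), Real.arctan (1 / p.2))) ''
      (exceptionalSet ℓ ∩ {p | p.2 ≠ 0})) = 0 := by
  refine addHaar_image_eq_zero_of_differentiableOn_of_addHaar_eq_zero volume ?_
    (measure_mono_null inter_subset_left (volume_exceptionalSet hℓ))
  intro p hp
  have hp2 : p.2 ≠ 0 := hp.2
  have h1 : DifferentiableAt ℝ (fun p : ℝ × ℝ => p.1 / p.2) p := by
    fun_prop (disch := exact hp2)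
  have h2 : DifferentiableAt ℝ (fun p : ℝ × ℝ => 1 / p.2) p := by
    fun_prop (disch := exact hp2)
  exact (h1.arctan.prodMk h2.arctan).differentiableWithinAt

lemma hasRotationNumber_of_not_irrational {f : UnitAddCircle → UnitAddCircle} {F : CircleDeg1Lift}
    (hF : IsLift f F) (h : ¬ Irrational F.translationNumber) :
    ∃ r : ℚ, HasRotationNumber f (r : ℝ) := by
  obtain ⟨r, hr⟩ := not_not.1 h
  exact ⟨Int.fract r, F, hF, by rw [← hr, Rat.cast_fract]⟩

end InternalWave

theorem mainTheorem2 (ℓ : ℝ) (hℓ : 0 < ℓ) :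
    (∀ α θ : ℝ, 0 < α → α < θ → θ < Real.pi / 2 →
      (∀ x x' : UnitAddCircle,
        InternalWave.IsFirstReturn ℓ α θ x x' ↔ x' = InternalWave.returnMap ℓ α θ x) ∧
      IsHomeomorph (InternalWave.returnMap ℓ α θ)) ∧
    ∀ᵐ p : ℝ × ℝ ∂volume, 0 < p.1 → p.1 < p.2 → p.2 < Real.pi / 2 →
      ∃ r : ℚ, InternalWave.HasRotationNumber (InternalWave.returnMap ℓ p.1 p.2) (r : ℝ) := by
  refine ⟨fun α θ h1 h2 h3 => ?_, ?_⟩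
  · have H : InternalWave.Admissible ℓ α θ := ⟨hℓ, h1, h2, h3⟩
    exact ⟨InternalWave.isFirstReturn_iff H, (InternalWave.isLift_returnLift H).isHomeomorph⟩
  · rw [ae_iff]
    refine measure_mono_null ?_ (InternalWave.volume_image_exceptionalSet hℓ)
    rintro ⟨α, θ⟩ hp
    simp only [mem_ofPred_eq, Classical.not_imp] at hp
    obtain ⟨h1, h2, h3, h4⟩ := hp
    have H : InternalWave.Admissible ℓ α θ := ⟨hℓ, h1, h2, h3⟩
    refine InternalWave.irrational_mem_image H ?_
    by_contra hrat
    exact h4 (InternalWave.hasRotationNumber_of_not_irrational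
      (InternalWave.isLift_returnLift H) hrat)
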